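/- **Proposition 1.2.** Let $M$ be an $n$-dimensional compact smooth Riemannian manifold without boundary, let $V\in C^\infty(M)$ be such that $d\mu=e^{V}dx$ ($dx$ the Riemannian volume) is a probability measure, and let $L=\Delta+\nabla V\cdot\nabla$, where $\Delta$ is the Laplace–Beltrami operator. Put $$\Gamma(f,g)=\tfrac12\big(L(fg)-fLg-gLf\big),\qquad \Gamma_2(f,g)=\tfrac12\big(L\Gamma(f,g)-\Gamma(Lf,g)-\Gamma(f,Lg)\big),$$ and $\Gamma(f)=\Gamma(f,f)$, $\Gamma_2(f)=\Gamma_2(f,f)$. Let $I\subset\mathbb R$ be an interval with more than one point and let $\Phi:I\to\mathbb R$ be a smooth convex function such that $\Phi''$ does not vanish on $I$ and both $\Phi''$ and $-1/\Phi''$ are convex (derivatives at end points of $I$ belonging to $I$ are one-sided). For $f\in C^\infty(M)$ with values in $I$ put $$q_\Phi(f)=\int_M\Phi''(f)\,\Gamma(f)\,d\mu,\qquad C_\Phi(f)=\int_M f^2\,\Phi''(f)\,d\mu .$$ Let $K\in\mathbb R$ and $m>0$, and suppose that $L$ satisfies the pointwise curvature-dimension condition $CD(K,m)$: $$\Gamma_2(f)\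 \ge\ K\,\Gamma(f)+\frac1m\,(Lf)^2\quad\text{on } M,\ \text{ for all } f\in C^\infty(M).$$ Then the integral form curvature-dimension condition holds: for every $f\in C^\infty(M)$ with values in $I$, $$\int_M\bigg[\frac{2\,\Gamma_2(\Phi'(f))}{\Phi''(f)}-\Big(\frac1{\Phi''}\Big)''(f)\,\big(\Phi''(f)\,\Gamma(f)\big)^2\bigg]d\mu\ \ge\ 2K\,q_\Phi(f)+\frac{2\,q_\Phi(f)^2}{m\,C_\Phi(f)},$$ where the last term is read as $0$ if $f\equiv0$ (the only case in which $C_\Phi(f)=0$; then also $q_\Phi(f)=0$). -/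

import Mathlib

open MeasureTheory
open scoped Manifold ContDiff Bundle

noncomputable section

namespace BakryEmery

/-! Throughout, `M` is a smooth `n`-dimensional manifold without boundary, modelled on `ℝⁿ`, whose
tangent spaces carry inner products `⟪·,·⟫` (the Riemannian metric). Functions on `M` are plain maps
`M → ℝ`; smoothness is a separate hypothesis where it is needed. -/

section Riemannian

variable (n : ℕ) {M : Type*} [TopologicalSpace M] [ChartedSpace (EuclideanSpace ℝ (Fin n)) M]
  [IsManifold (𝓡 n) ∞ M] [Bundle.RiemannianBundle (fun x : M ↦ TangentSpace (𝓡 n) x)]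

/-- The `i`-th partial derivative of a function on `ℝⁿ`. -/
def partialDeriv {n : ℕ} (i : Fin n) (F : EuclideanSpace ℝ (Fin n) → ℝ)
    (u : EuclideanSpace ℝ (Fin n)) : ℝ :=
  fderiv ℝ F u (EuclideanSpace.single i 1)

/-- The coordinate vector field `∂ᵢ` of the preferred chart `φ` at `p`, at the point `φ⁻¹(u)`. -/
def coordVector (p : M) (u : EuclideanSpace ℝ (Fin n)) (i : Fin n) :
    TangentSpace (𝓡 n) ((extChartAt (𝓡 n) p).symm u) :=
  mfderiv 𝓘(ℝ, EuclideanSpace ℝ (Fin n)) (𝓡 n) (extChartAt (𝓡 n) p).symm u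
    (EuclideanSpace.single i (1 : ℝ) : EuclideanSpace ℝ (Fin n))

/-- The matrix `gᵢⱼ(u) = ⟪∂ᵢ, ∂ⱼ⟫` of the Riemannian metric in the preferred chart at `p`. -/
def metricMatrix (p : M) (u : EuclideanSpace ℝ (Fin n)) : Matrix (Fin n) (Fin n) ℝ :=
  Matrix.of fun i j ↦ inner ℝ (coordVector n p u i) (coordVector n p u j)

/-- The volume density `√(det g)` in the preferred chart at `p`. -/
def volumeDensity (p : M) (u : EuclideanSpace ℝ (Fin n)) : ℝ :=
  Real.sqrt (metricMatrix n p u).det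

/-- The (finite-dimensional) tangent spaces are complete for the Riemannian norm. -/
instance instCompleteSpaceTangentSpace (x : M) : CompleteSpace (TangentSpace (𝓡 n) x) :=
  haveI : FiniteDimensional ℝ (TangentSpace (𝓡 n) x) :=
    inferInstanceAs (FiniteDimensional ℝ (EuclideanSpace ℝ (Fin n)))
  FiniteDimensional.complete ℝ _

/-- The gradient `∇f` for the Riemannian metric: `⟪∇f(x), v⟫ = df(x) v`. -/
def gradient (f : M → ℝ) (x : M) : TangentSpace (𝓡 n) x :=
  (InnerProductSpace.toDual ℝ (TangentSpace (𝓡 n) x)).symm (mfderiv (𝓡 n) 𝓘(ℝ, ℝ) f x)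

/-- The Laplace–Beltrami operator
`Δf = (det g)^{-1/2} ∑ᵢ ∂ᵢ ((det g)^{1/2} ∑ⱼ gⁱʲ ∂ⱼ f)`,
computed at `x` in the preferred chart at `x`. -/
def laplaceBeltrami (f : M → ℝ) (x : M) : ℝ :=
  (volumeDensity n x (extChartAt (𝓡 n) x x))⁻¹ *
    ∑ i, partialDeriv i
      (fun u ↦ volumeDensity n x u *
        ∑ j, (metricMatrix n x u)⁻¹ i j * partialDeriv j (f ∘ (extChartAt (𝓡 n) x).symm) u)
      (extChartAt (𝓡 n) x x)

/-- The diffusion operator `L = Δ + ∇V · ∇`. -/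
def diffusionOp (V f : M → ℝ) (x : M) : ℝ :=
  laplaceBeltrami n f x + inner ℝ (gradient n V x) (gradient n f x)

/-- The carré du champ operator `Γ(f, g) = ½ (L(fg) - f Lg - g Lf)`. -/
def carreDuChamp (V f g : M → ℝ) (x : M) : ℝ :=
  (diffusionOp n V (fun y ↦ f y * g y) x - f x * diffusionOp n V g x - g x * diffusionOp n V f x) / 2

/-- The iterated carré du champ operator `Γ₂(f, g) = ½ (LΓ(f, g) - Γ(Lf, g) - Γ(f, Lg))`. -/
def carreDuChamp₂ (V f g : M → ℝ) (x : M) : ℝ :=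
  (diffusionOp n V (carreDuChamp n V f g) x - carreDuChamp n V (diffusionOp n V f) g x
    - carreDuChamp n V f (diffusionOp n V g) x) / 2

/-- The pointwise curvature-dimension condition `CD(K, m)`:
`Γ₂(f) ≥ K Γ(f) + (Lf)² / m` on `M`, for all `f ∈ C^∞(M)`. -/
def CurvatureDimension (V : M → ℝ) (K m : ℝ) : Prop :=
  ∀ f : M → ℝ, ContMDiff (𝓡 n) 𝓘(ℝ, ℝ) ∞ f → ∀ x : M,
    carreDuChamp₂ n V f f x ≥ K * carreDuChamp n V f f x + (diffusionOp n V f x) ^ 2 / m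

variable [MeasurableSpace M]

/-- The measure `√(det g) du` on the image of the preferred chart `φ` at `p`, transported to the
domain of that chart by `φ⁻¹`. -/
def chartVolume (p : M) : Measure M :=
  Measure.map (extChartAt (𝓡 n) p).symm
    ((volume.restrict (extChartAt (𝓡 n) p).target).withDensity
      fun u ↦ ENNReal.ofReal (volumeDensity n p u))

/-- The Riemannian volume measure `dx`: the measure that is given by `√(det g) du` in each chart.
The measures `chartVolume p` agree on the overlaps of the chart domains (change of variables), so
that the measure restricting to each of them is their supremum in the lattice of measures. -/
def riemannianVolume : Measure M :=
  ⨆ p : M, chartVolume n p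

/-- The measure `dμ = e^V dx`. -/
def weightedVolume (V : M → ℝ) : Measure M :=
  (riemannianVolume n).withDensity fun x ↦ ENNReal.ofReal (Real.exp (V x))

/-- `q_Φ(f) = ∫ Φ''(f) Γ(f) dμ`, for `Φ` defined on the interval `J`. The derivatives of `Φ` are
taken within `J`, that is, they are one-sided at the end points of `J` that belong to `J`. -/
def qPhi (V : M → ℝ) (J : Set ℝ) (Φ : ℝ → ℝ) (f : M → ℝ) : ℝ :=
  ∫ x, iteratedDerivWithin 2 Φ J (f x) * carreDuChamp n V f f x ∂(weightedVolume n V)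

/-- `C_Φ(f) = ∫ f² Φ''(f) dμ`. -/
def cPhi (V : M → ℝ) (J : Set ℝ) (Φ : ℝ → ℝ) (f : M → ℝ) : ℝ :=
  ∫ x, f x ^ 2 * iteratedDerivWithin 2 Φ J (f x) ∂(weightedVolume n V)

/-- The integral form curvature-dimension condition: for all `f ∈ C^∞(M)` with values in `J`,
`∫ [2 Γ₂(Φ'(f)) / Φ''(f) - (1/Φ'')''(f) (Φ''(f) Γ(f))²] dμ ≥ 2 K q_Φ(f) + 2 q_Φ(f)² / (m C_Φ(f))`.
If `C_Φ(f) = 0` then `f` vanishes identically and `q_Φ(f) = 0`; the last term is then `0`. -/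
def IntegralCurvatureDimension (V : M → ℝ) (J : Set ℝ) (Φ : ℝ → ℝ) (K m : ℝ) : Prop :=
  ∀ f : M → ℝ, ContMDiff (𝓡 n) 𝓘(ℝ, ℝ) ∞ f → (∀ x, f x ∈ J) →
    ∫ x, (2 * carreDuChamp₂ n V (fun y ↦ derivWithin Φ J (f y)) (fun y ↦ derivWithin Φ J (f y)) x
            / iteratedDerivWithin 2 Φ J (f x)
          - iteratedDerivWithin 2 (fun s ↦ 1 / iteratedDerivWithin 2 Φ J s) J (f x)
            * (iteratedDerivWithin 2 Φ J (f x) * carreDuChamp n V f f x) ^ 2) ∂(weightedVolume n V)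
      ≥ 2 * K * qPhi n V J Φ f + 2 * qPhi n V J Φ f ^ 2 / (m * cPhi n V J Φ f)

end Riemannian

end BakryEmery

end

/-! The analytic argument is short. Apply the pointwise condition to `h = Φ'(f)`, for which `Γ(h) =
Φ''(f)² Γ(f)`, and divide by `Φ''(f) > 0`. Convexity of `-1/Φ''` makes the term with `(1/Φ'')''`
nonnegative, so it can be dropped. Integration leaves `2K q + (2/m) ∫ (Lh)² / Φ''(f) dμ` as a lower
bound. Since `L` is symmetric, `∫ f Lh dμ = -∫ Γ(f, h) dμ = -q`, and Cauchy–Schwarz with weight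
`Φ''(f)` bounds `q² / C` by the last integral (`sq_integral_mul_div_le`).

Most of the work is to show that `L` is a diffusion operator. The definition computes `Δh(x)` in the
preferred chart at `x`, so even smoothness of `Δh` requires chart independence. This is proved
weakly. In one fixed chart, Euclidean integration by parts gives `∫ w Δh = -∫ ⟪∇w, ∇h⟫` for `w`
supported in that chart (`integral_mul_chartLaplacian`). The right side involves no chart, and
continuous functions are determined by their integrals against test functions
(`eqOn_of_integral_mul_eq`), so chart Laplacians agree on overlaps. A partition of unity makes
Green's formula global. Testing once more gives the product rule for `Δ`, hence `Γ(f, g) = ⟪∇f,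
∇g⟫`.

All of this presupposes that the supremum of the chart volumes restricts to each of them, which is
the change of variables formula together with a countable cover. -/

noncomputable section

namespace BakryEmery

/-! ### Linear algebra of Gram matrices -/

/-- Inner products are computed with the inverse Gram matrix of a basis. -/
lemma inner_eq_sum_gram_inv {ι F : Type*} [Fintype ι] [DecidableEq ι] [NormedAddCommGroup F]
    [InnerProductSpace ℝ F] (b : Module.Basis ι ℝ F) (v w : F) :
    inner ℝ v w = ∑ i, ∑ j, (Matrix.gram ℝ b)⁻¹ i j * inner ℝ v (b i) * inner ℝ w (b j) := by
  set G := Matrix.gram ℝ b with hG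
  have hpos : G.PosDef := Matrix.posDef_gram_of_linearIndependent b.linearIndependent
  have hinv : G⁻¹ * G = 1 := Matrix.nonsing_inv_mul _ hpos.det_pos.ne'.isUnit
  have hw : ∀ j, inner ℝ w (b j) = ∑ k, b.repr w k * G k j := fun j ↦ by
    conv_lhs => rw [← b.sum_repr w]
    rw [sum_inner]
    simp [inner_smul_left, hG, Matrix.gram]
  have hs : ∀ k j, G k j = G j k := fun k j ↦ by
    simp [hG, Matrix.gram, real_inner_comm]
  -- The vector of pairings of `w` with the basis is `G` applied to its coordinates, so `G⁻¹`
  -- recovers the coordinates.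
  have key : ∀ i, ∑ j, G⁻¹ i j * inner ℝ w (b j) = b.repr w i := fun i ↦ by
    calc ∑ j, G⁻¹ i j * inner ℝ w (b j)
        = ∑ j, ∑ k, b.repr w k * (G⁻¹ i j * G j k) := by
          refine Finset.sum_congr rfl fun j _ ↦ ?_
          rw [hw, Finset.mul_sum]
          exact Finset.sum_congr rfl fun k _ ↦ by rw [hs k j]; ring
      _ = ∑ k, b.repr w k * (G⁻¹ * G) i k := by
          rw [Finset.sum_comm]
          exact Finset.sum_congr rfl fun k _ ↦ by rw [Matrix.mul_apply, Finset.mul_sum]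
      _ = b.repr w i := by simp [hinv, Matrix.one_apply]
  conv_lhs => rw [← b.sum_repr w, inner_sum]
  refine Finset.sum_congr rfl fun i _ ↦ ?_
  rw [inner_smul_right, ← key i, Finset.sum_mul]
  exact Finset.sum_congr rfl fun j _ ↦ by ring

lemma inner_eq_sum_gram_inv_of_linearIndependent {ι F : Type*} [Fintype ι] [DecidableEq ι]
    [NormedAddCommGroup F] [InnerProductSpace ℝ F] {b : ι → F} (hb : LinearIndependent ℝ b)
    (hcard : Fintype.card ι = Module.finrank ℝ F) [FiniteDimensional ℝ F] (v w : F) :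
    inner ℝ v w = ∑ i, ∑ j, (Matrix.gram ℝ b)⁻¹ i j * inner ℝ v (b i) * inner ℝ w (b j) := by
  simpa using inner_eq_sum_gram_inv (basisOfLinearIndependentOfCardEqFinrank' b hb hcard) v w

/-! ### Charts and coordinate vector fields -/

section Chart

variable {n : ℕ} {M : Type*} [TopologicalSpace M] [ChartedSpace (EuclideanSpace ℝ (Fin n)) M]
  [IsManifold (𝓡 n) ∞ M]

lemma mdifferentiableAt_chart_symm {p : M} {u : EuclideanSpace ℝ (Fin n)}
    (hu : u ∈ (extChartAt (𝓡 n) p).target) :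
    MDifferentiableAt 𝓘(ℝ, EuclideanSpace ℝ (Fin n)) (𝓡 n) (extChartAt (𝓡 n) p).symm u := by
  have := mdifferentiableWithinAt_extChartAt_symm (I := 𝓡 n) hu
  rwa [ModelWithCorners.range_eq_univ, mdifferentiableWithinAt_univ] at this

lemma contDiffOn_comp_chart_symm {f : M → ℝ} (hf : ContMDiff (𝓡 n) 𝓘(ℝ, ℝ) ∞ f) (p : M) :
    ContDiffOn ℝ ∞ (f ∘ (extChartAt (𝓡 n) p).symm) (extChartAt (𝓡 n) p).target :=
  (hf.comp_contMDiffOn (contMDiffOn_extChartAt_symm p)).contDiffOn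

local notation "𝔼" => EuclideanSpace ℝ (Fin n)

/-- The field is the tangent map of the inverse chart applied to a constant section. This is what
makes the metric coefficients smooth. -/
lemma contMDiffOn_coordVector (p : M) (i : Fin n) :
    ContMDiffOn 𝓘(ℝ, 𝔼) (𝓡 n).tangent ∞
      (fun u ↦ (⟨(extChartAt (𝓡 n) p).symm u, coordVector n p u i⟩ : TangentBundle (𝓡 n) M))
      (extChartAt (𝓡 n) p).target := by
  have h1 := (contMDiffOn_extChartAt_symm (I := 𝓡 n) (n := ∞) p).contMDiffOn_tangentMapWithin
    (m := ∞) le_rfl (isOpen_extChartAt_target p).uniqueMDiffOn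
  have h2 : ContMDiff 𝓘(ℝ, 𝔼) 𝓘(ℝ, 𝔼).tangent ∞
      (fun u : 𝔼 ↦ (⟨u, EuclideanSpace.single i (1 : ℝ)⟩ : TangentBundle 𝓘(ℝ, 𝔼) 𝔼)) := by
    exact contMDiff_vectorSpace_iff_contDiff.2 contDiff_const
  refine (h1.comp (h2.contMDiffOn (s := (extChartAt (𝓡 n) p).target)) (fun u hu ↦ hu)).congr ?_
  intro u hu
  simp only [Function.comp_apply, tangentMapWithin]
  rw [mfderivWithin_of_isOpen (isOpen_extChartAt_target p) hu]
  rfl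

lemma linearIndependent_coordVector {p : M} {u : 𝔼} (hu : u ∈ (extChartAt (𝓡 n) p).target) :
    LinearIndependent ℝ (coordVector n p u) := by
  have h := isInvertible_mfderivWithin_extChartAt_symm (I := 𝓡 n) hu
  rw [ModelWithCorners.range_eq_univ, mfderivWithin_univ] at h
  have hb := (EuclideanSpace.basisFun (Fin n) ℝ).toBasis.linearIndependent
  have := hb.map' (mfderiv 𝓘(ℝ, 𝔼) (𝓡 n) (extChartAt (𝓡 n) p).symm u).toLinearMap
    (LinearMap.ker_eq_bot.2 h.bijective.injective)
  have e : coordVector n p u = (mfderiv 𝓘(ℝ, 𝔼) (𝓡 n) (extChartAt (𝓡 n) p).symm u).toLinearMap ∘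
      (EuclideanSpace.basisFun (Fin n) ℝ).toBasis := by
    funext i
    refine congrArg (mfderiv 𝓘(ℝ, 𝔼) (𝓡 n) (extChartAt (𝓡 n) p).symm u) ?_
    rw [OrthonormalBasis.coe_toBasis]
    exact (EuclideanSpace.basisFun_apply (Fin n) ℝ i).symm
  rw [e]
  exact this

lemma mfderiv_coordVector {f : M → ℝ} {p : M} {u : 𝔼} (hu : u ∈ (extChartAt (𝓡 n) p).target)
    (hf : MDifferentiableAt (𝓡 n) 𝓘(ℝ, ℝ) f ((extChartAt (𝓡 n) p).symm u)) (i : Fin n) :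
    mfderiv (𝓡 n) 𝓘(ℝ, ℝ) f ((extChartAt (𝓡 n) p).symm u) (coordVector n p u i) =
      partialDeriv i (f ∘ (extChartAt (𝓡 n) p).symm) u := by
  rw [partialDeriv, ← mfderiv_eq_fderiv, mfderiv_comp u hf (mdifferentiableAt_chart_symm hu)]
  rfl

end Chart

lemma inner_gradient_left {n : ℕ} {M : Type*} [TopologicalSpace M]
    [ChartedSpace (EuclideanSpace ℝ (Fin n)) M]
    [Bundle.RiemannianBundle (fun x : M ↦ TangentSpace (𝓡 n) x)]
    (f : M → ℝ) (x : M) (v : TangentSpace (𝓡 n) x) :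
    inner ℝ (gradient n f x) v = mfderiv (𝓡 n) 𝓘(ℝ, ℝ) f x v :=
  InnerProductSpace.toDual_symm_apply (𝕜 := ℝ)

/-! ### The metric, its inverse and its density in coordinates -/

section Coordinates

variable {n : ℕ} {M : Type*} [TopologicalSpace M] [ChartedSpace (EuclideanSpace ℝ (Fin n)) M]
  [IsManifold (𝓡 n) ∞ M] [Bundle.RiemannianBundle (fun x : M ↦ TangentSpace (𝓡 n) x)]

local notation "𝔼" => EuclideanSpace ℝ (Fin n)

lemma posDef_metricMatrix {p : M} {u : 𝔼} (hu : u ∈ (extChartAt (𝓡 n) p).target) :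
    (metricMatrix n p u).PosDef :=
  Matrix.posDef_gram_of_linearIndependent (linearIndependent_coordVector hu)

lemma volumeDensity_pos {p : M} {u : 𝔼} (hu : u ∈ (extChartAt (𝓡 n) p).target) :
    0 < volumeDensity n p u :=
  Real.sqrt_pos.2 (posDef_metricMatrix hu).det_pos

/-- The pairing of gradients in coordinates: `⟪∇f, ∇h⟫ = ∑ gⁱʲ ∂ᵢf ∂ⱼh`. -/
lemma inner_gradient_eq_sum {f h : M → ℝ} {p : M} {u : 𝔼}
    (hu : u ∈ (extChartAt (𝓡 n) p).target)
    (hf : MDifferentiableAt (𝓡 n) 𝓘(ℝ, ℝ) f ((extChartAt (𝓡 n) p).symm u))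
    (hh : MDifferentiableAt (𝓡 n) 𝓘(ℝ, ℝ) h ((extChartAt (𝓡 n) p).symm u)) :
    inner ℝ (gradient n f ((extChartAt (𝓡 n) p).symm u))
        (gradient n h ((extChartAt (𝓡 n) p).symm u)) =
      ∑ i, ∑ j, (metricMatrix n p u)⁻¹ i j * partialDeriv i (f ∘ (extChartAt (𝓡 n) p).symm) u *
        partialDeriv j (h ∘ (extChartAt (𝓡 n) p).symm) u := by
  have hcard : Fintype.card (Fin n) =
      Module.finrank ℝ (TangentSpace (𝓡 n) ((extChartAt (𝓡 n) p).symm u)) := by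
    rw [Fintype.card_fin]
    exact (finrank_euclideanSpace_fin (𝕜 := ℝ)).symm
  have hfd : FiniteDimensional ℝ (TangentSpace (𝓡 n) ((extChartAt (𝓡 n) p).symm u)) :=
    inferInstanceAs (FiniteDimensional ℝ 𝔼)
  have key := inner_eq_sum_gram_inv_of_linearIndependent (b := coordVector n p u)
    (linearIndependent_coordVector hu) hcard
    (gradient n f ((extChartAt (𝓡 n) p).symm u)) (gradient n h ((extChartAt (𝓡 n) p).symm u))
  refine key.trans ?_
  refine Finset.sum_congr rfl fun i _ ↦ Finset.sum_congr rfl fun j _ ↦ ?_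
  refine congrArg₂ (· * ·) (congrArg₂ (· * ·) ?_ ?_) ?_
  · rfl
  · exact (inner_gradient_left _ _ _).trans (mfderiv_coordVector hu hf i)
  · exact (inner_gradient_left _ _ _).trans (mfderiv_coordVector hu hh j)

section Smooth

variable [IsContMDiffRiemannianBundle (𝓡 n) ∞ (EuclideanSpace ℝ (Fin n))
      (fun x : M ↦ TangentSpace (𝓡 n) x)]

lemma contDiffOn_metricMatrix (p : M) (i j : Fin n) :
    ContDiffOn ℝ ∞ (fun u ↦ metricMatrix n p u i j) (extChartAt (𝓡 n) p).target :=
  (ContMDiffOn.inner_bundle (F := 𝔼) (E := fun x : M ↦ TangentSpace (𝓡 n) x)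
    (contMDiffOn_coordVector p i) (contMDiffOn_coordVector p j)).contDiffOn

lemma _root_.ContDiffOn.matrix_det {E ι : Type*} [NormedAddCommGroup E] [NormedSpace ℝ E]
    [Fintype ι] [DecidableEq ι] {s : Set E} {k : ℕ∞ω} {A : E → Matrix ι ι ℝ}
    (hA : ∀ i j, ContDiffOn ℝ k (fun u ↦ A u i j) s) : ContDiffOn ℝ k (fun u ↦ (A u).det) s := by
  simp only [Matrix.det_apply]
  exact ContDiffOn.sum fun σ _ ↦ (contDiffOn_prod fun i _ ↦ hA _ _).const_smul _

lemma contDiffOn_volumeDensity (p : M) :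
    ContDiffOn ℝ ∞ (volumeDensity n p) (extChartAt (𝓡 n) p).target :=
  (ContDiffOn.matrix_det (contDiffOn_metricMatrix p)).sqrt
    fun _ hu ↦ (posDef_metricMatrix hu).det_pos.ne'

/-- Cramer's rule: adjugate entries are determinants with smooth entries, and the determinant of the
metric does not vanish. -/
lemma contDiffOn_metricMatrix_inv (p : M) (i j : Fin n) :
    ContDiffOn ℝ ∞ (fun u ↦ (metricMatrix n p u)⁻¹ i j) (extChartAt (𝓡 n) p).target := by
  have hadj : ContDiffOn ℝ ∞ (fun u ↦ (metricMatrix n p u).adjugate i j)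
      (extChartAt (𝓡 n) p).target := by
    simp only [Matrix.adjugate_apply]
    refine ContDiffOn.matrix_det fun k l ↦ ?_
    by_cases hk : k = j
    · subst hk
      simpa using contDiffOn_const
    · simpa [Matrix.updateRow_ne hk] using contDiffOn_metricMatrix p k l
  refine (((ContDiffOn.matrix_det (contDiffOn_metricMatrix p)).inv
    fun _ hu ↦ (posDef_metricMatrix hu).det_pos.ne').mul hadj).congr fun u _ ↦ ?_
  simp [Matrix.inv_def]

lemma _root_.ContDiffOn.partialDeriv {F : EuclideanSpace ℝ (Fin n) → ℝ}
    {U : Set (EuclideanSpace ℝ (Fin n))} (hF : ContDiffOn ℝ ∞ F U) (hU : IsOpen U) (i : Fin n) :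
    ContDiffOn ℝ ∞ (BakryEmery.partialDeriv i F) U :=
  (hF.fderiv_of_isOpen hU le_rfl).clm_apply contDiffOn_const

end Smooth
end Coordinates

/-! ### The Riemannian volume: gluing the chart volumes -/

/-- The supremum of a family of measures that agree on overlaps of the sets on which they are
concentrated restricts to each member of the family. -/
lemma iSup_measure_apply_of_compatible {X ι : Type*} [MeasurableSpace X] {χ : ι → Measure X}
    {U : ι → Set X} (hU : ∀ i, MeasurableSet (U i)) {s : ℕ → ι} (hs : ⋃ k, U (s k) = Set.univ)
    (hχ : ∀ i, χ i (U i)ᶜ = 0)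
    (hcompat : ∀ i j A, MeasurableSet A → A ⊆ U i → A ⊆ U j → χ i A = χ j A)
    {i : ι} {A : Set X} (hA : MeasurableSet A) (hAi : A ⊆ U i) :
    (⨆ i, χ i) A = χ i A := by
  refine le_antisymm ?_ (Measure.le_iff'.1 (le_iSup χ i) A)
  set D : ℕ → Set X := disjointed fun k ↦ U (s k) with hD
  have hDm : ∀ k, MeasurableSet (D k) := fun k ↦ MeasurableSet.disjointed (fun k ↦ hU _) k
  have hDU : ∀ k, D k ⊆ U (s k) := fun k ↦ disjointed_subset _ k
  have hDd : Pairwise (Function.onFun Disjoint D) := disjoint_disjointed _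
  have hDuniv : ⋃ k, D k = Set.univ := by rw [hD, iUnion_disjointed, hs]
  have hsum : ∀ (ν : Measure X) (B : Set X), MeasurableSet B → ν B = ∑' k, ν (B ∩ D k) := by
    intro ν B hB
    rw [← measure_iUnion, ← Set.inter_iUnion, hDuniv, Set.inter_univ]
    · exact fun k l hkl ↦ (hDd hkl).mono Set.inter_subset_right Set.inter_subset_right
    · exact fun k ↦ hB.inter (hDm k)
  -- Glue the members along a disjointed countable cover. By compatibility `ν` dominates every `χ
  -- j`, hence the supremum, while it still agrees with `χ i` inside `U i`.
  set ν : Measure X := Measure.sum fun k ↦ (χ (s k)).restrict (D k) with hν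
  have hνB : ∀ B, MeasurableSet B → ν B = ∑' k, χ (s k) (B ∩ D k) := fun B hB ↦ by
    rw [hν, Measure.sum_apply _ hB]
    exact tsum_congr fun k ↦ Measure.restrict_apply hB
  have hle : ⨆ i, χ i ≤ ν := by
    refine iSup_le fun j ↦ Measure.le_iff.2 fun B hB ↦ ?_
    have h1 : χ j B = χ j (B ∩ U j) := (measure_inter_conull (hχ j)).symm
    rw [h1, hsum _ _ (hB.inter (hU j)), hνB B hB]
    refine ENNReal.tsum_le_tsum fun k ↦ ?_
    rw [hcompat j (s k) _ ((hB.inter (hU j)).inter (hDm k))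
      (fun x hx ↦ hx.1.2) (fun x hx ↦ hDU k hx.2)]
    exact measure_mono fun x hx ↦ ⟨hx.1.1, hx.2⟩
  refine (Measure.le_iff'.1 hle A).trans_eq ?_
  rw [hνB A hA, hsum (χ i) A hA]
  exact tsum_congr fun k ↦ hcompat (s k) i _ (hA.inter (hDm k)) (fun x hx ↦ hDU k hx.2)
    (fun x hx ↦ hAi hx.1)

section ChartChange

variable {n : ℕ} {M : Type*} [TopologicalSpace M] [ChartedSpace (EuclideanSpace ℝ (Fin n)) M]
  [IsManifold (𝓡 n) ∞ M]

local notation "𝔼" => EuclideanSpace ℝ (Fin n)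

lemma differentiableAt_chart_change {p q : M} {u : 𝔼} (hu : u ∈ (extChartAt (𝓡 n) p).target)
    (hq : (extChartAt (𝓡 n) p).symm u ∈ (extChartAt (𝓡 n) q).source) :
    DifferentiableAt ℝ (extChartAt (𝓡 n) q ∘ (extChartAt (𝓡 n) p).symm) u := by
  rw [← mdifferentiableAt_iff_differentiableAt]
  rw [extChartAt_source] at hq
  exact (mdifferentiableAt_extChartAt hq).comp u (mdifferentiableAt_chart_symm hu)

/-- Chain rule, as one inverse chart is locally the other composed with the transition map. Both
sides are read in the model space because the two base points are only propositionally equal. -/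
lemma mfderiv_chart_symm_change {p q : M} {u : 𝔼} (hu : u ∈ (extChartAt (𝓡 n) p).target)
    (hq : (extChartAt (𝓡 n) p).symm u ∈ (extChartAt (𝓡 n) q).source) (v : 𝔼) :
    (mfderiv 𝓘(ℝ, 𝔼) (𝓡 n) (extChartAt (𝓡 n) p).symm u v : 𝔼) =
      mfderiv 𝓘(ℝ, 𝔼) (𝓡 n) (extChartAt (𝓡 n) q).symm
        ((extChartAt (𝓡 n) q ∘ (extChartAt (𝓡 n) p).symm) u)
        (fderiv ℝ (extChartAt (𝓡 n) q ∘ (extChartAt (𝓡 n) p).symm) u v) := by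
  have hev : (extChartAt (𝓡 n) p).symm =ᶠ[nhds u]
      (extChartAt (𝓡 n) q).symm ∘ (extChartAt (𝓡 n) q ∘ (extChartAt (𝓡 n) p).symm) := by
    have h1 := (mdifferentiableAt_chart_symm (n := n) hu).continuousAt.preimage_mem_nhds
      ((isOpen_extChartAt_source (I := 𝓡 n) q).mem_nhds hq)
    filter_upwards [h1] with w hw
    simp only [Function.comp_apply]
    exact ((extChartAt (𝓡 n) q).left_inv hw).symm
  have hT := (differentiableAt_chart_change hu hq).mdifferentiableAt
  have hTu : (extChartAt (𝓡 n) q ∘ (extChartAt (𝓡 n) p).symm) u ∈ (extChartAt (𝓡 n) q).target :=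
    (extChartAt (𝓡 n) q).map_source hq
  rw [hev.mfderiv_eq, mfderiv_comp u (mdifferentiableAt_chart_symm hTu) hT, mfderiv_eq_fderiv]
  rfl

end ChartChange

section Volume

variable {n : ℕ} {M : Type*} [TopologicalSpace M] [ChartedSpace (EuclideanSpace ℝ (Fin n)) M]
  [IsManifold (𝓡 n) ∞ M] [Bundle.RiemannianBundle (fun x : M ↦ TangentSpace (𝓡 n) x)]

local notation "𝔼" => EuclideanSpace ℝ (Fin n)

/-- The Riemannian metric as a family of bilinear forms on the model space. -/
def metricForm (n : ℕ) {M : Type*} [TopologicalSpace M]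
    [ChartedSpace (EuclideanSpace ℝ (Fin n)) M]
    [Bundle.RiemannianBundle (fun x : M ↦ TangentSpace (𝓡 n) x)] (x : M)
    (v w : EuclideanSpace ℝ (Fin n)) : ℝ :=
  @inner ℝ (TangentSpace (𝓡 n) x) _ v w

lemma inner_map_map_eq_sum {ι F : Type*} [Fintype ι] [DecidableEq ι] [NormedAddCommGroup F]
    [InnerProductSpace ℝ F] (L : EuclideanSpace ℝ ι →ₗ[ℝ] F) (v w : EuclideanSpace ℝ ι) :
    inner ℝ (L v) (L w) = ∑ l, (∑ k, v k *
      inner ℝ (L (EuclideanSpace.single k 1)) (L (EuclideanSpace.single l 1))) * w l := by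
  have h : ∀ v : EuclideanSpace ℝ ι, L v = ∑ k, v k • L (EuclideanSpace.single k 1) := fun v ↦ by
    conv_lhs => rw [← (EuclideanSpace.basisFun ι ℝ).sum_repr v]
    simp
  rw [h v, h w, inner_sum]
  refine Finset.sum_congr rfl fun l _ ↦ ?_
  rw [sum_inner, Finset.sum_mul]
  refine Finset.sum_congr rfl fun k _ ↦ ?_
  rw [inner_smul_left, inner_smul_right]
  simp only [conj_trivial]
  ring

lemma metricMatrix_chart_change {p q : M} {u : 𝔼} (hu : u ∈ (extChartAt (𝓡 n) p).target)
    (hq : (extChartAt (𝓡 n) p).symm u ∈ (extChartAt (𝓡 n) q).source) :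
    metricMatrix n p u =
      (LinearMap.toMatrix (EuclideanSpace.basisFun (Fin n) ℝ).toBasis
        (EuclideanSpace.basisFun (Fin n) ℝ).toBasis
        (fderiv ℝ (extChartAt (𝓡 n) q ∘ (extChartAt (𝓡 n) p).symm) u).toLinearMap).transpose *
      metricMatrix n q ((extChartAt (𝓡 n) q ∘ (extChartAt (𝓡 n) p).symm) u) *
      LinearMap.toMatrix (EuclideanSpace.basisFun (Fin n) ℝ).toBasis
        (EuclideanSpace.basisFun (Fin n) ℝ).toBasis
        (fderiv ℝ (extChartAt (𝓡 n) q ∘ (extChartAt (𝓡 n) p).symm) u).toLinearMap := by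
  set T := extChartAt (𝓡 n) q ∘ (extChartAt (𝓡 n) p).symm with hT
  have hpt : (extChartAt (𝓡 n) p).symm u = (extChartAt (𝓡 n) q).symm (T u) :=
    ((extChartAt (𝓡 n) q).left_inv hq).symm
  ext i j
  -- `metricForm` takes its vectors in the model space, so the base point can be rewritten without
  -- dependent types getting in the way.
  have h1 : metricMatrix n p u i j = metricForm n ((extChartAt (𝓡 n) p).symm u)
      (mfderiv 𝓘(ℝ, 𝔼) (𝓡 n) (extChartAt (𝓡 n) p).symm u (EuclideanSpace.single i (1 : ℝ) : 𝔼))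
      (mfderiv 𝓘(ℝ, 𝔼) (𝓡 n) (extChartAt (𝓡 n) p).symm u (EuclideanSpace.single j (1 : ℝ) : 𝔼)) := by
    rfl
  rw [h1, mfderiv_chart_symm_change hu hq, mfderiv_chart_symm_change hu hq, hpt]
  refine (inner_map_map_eq_sum (F := TangentSpace (𝓡 n) ((extChartAt (𝓡 n) q).symm (T u)))
    (mfderiv 𝓘(ℝ, 𝔼) (𝓡 n) (extChartAt (𝓡 n) q).symm (T u)).toLinearMap _ _).trans ?_
  rw [Matrix.mul_apply]
  refine Finset.sum_congr rfl fun l _ ↦ ?_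
  rw [Matrix.mul_apply]
  refine congrArg₂ (· * ·) (Finset.sum_congr rfl fun k _ ↦ congrArg₂ (· * ·) ?_ rfl) ?_
  · simp [LinearMap.toMatrix_apply, hT]
  · simp [LinearMap.toMatrix_apply, hT]

/-- The square root of the squared Jacobian determinant is its absolute value, exactly the factor in
the change of variables formula. -/
lemma volumeDensity_chart_change {p q : M} {u : 𝔼} (hu : u ∈ (extChartAt (𝓡 n) p).target)
    (hq : (extChartAt (𝓡 n) p).symm u ∈ (extChartAt (𝓡 n) q).source) :
    volumeDensity n p u =
      |(fderiv ℝ (extChartAt (𝓡 n) q ∘ (extChartAt (𝓡 n) p).symm) u).det| *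
        volumeDensity n q ((extChartAt (𝓡 n) q ∘ (extChartAt (𝓡 n) p).symm) u) := by
  rw [volumeDensity, metricMatrix_chart_change hu hq, Matrix.det_mul, Matrix.det_mul,
    Matrix.det_transpose, LinearMap.det_toMatrix, mul_right_comm, ← sq,
    Real.sqrt_mul (sq_nonneg _), Real.sqrt_sq_eq_abs]
  rfl

end Volume

lemma _root_.ContinuousOn.measurableSet_inter_preimage {X Y : Type*} [TopologicalSpace X]
    [MeasurableSpace X] [BorelSpace X] [TopologicalSpace Y] [MeasurableSpace Y] [BorelSpace Y]
    {g : X → Y} {t : Set X} (hg : ContinuousOn g t) (ht : MeasurableSet t) {A : Set Y}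
    (hA : MeasurableSet A) : MeasurableSet (t ∩ g ⁻¹' A) := by
  have := (continuousOn_iff_continuous_domRestrict.1 hg).measurable hA
  rw [← Subtype.image_preimage_coe]
  exact ht.subtype_image this

section Measurability

variable {n : ℕ} {M : Type*} [TopologicalSpace M] [ChartedSpace (EuclideanSpace ℝ (Fin n)) M]
  [MeasurableSpace M] [BorelSpace M]

lemma measurableSet_chart_image (p : M) {A : Set M} (hA : MeasurableSet A)
    (hAp : A ⊆ (extChartAt (𝓡 n) p).source) : MeasurableSet (extChartAt (𝓡 n) p '' A) := by
  rw [(extChartAt (𝓡 n) p).image_eq_target_inter_inv_preimage hAp]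
  exact (continuousOn_extChartAt_symm p).measurableSet_inter_preimage
    (isOpen_extChartAt_target p).measurableSet hA

lemma aemeasurable_chart_symm (p : M) : AEMeasurable (extChartAt (𝓡 n) p).symm
    ((volume : Measure (EuclideanSpace ℝ (Fin n))).restrict (extChartAt (𝓡 n) p).target) :=
  (continuousOn_extChartAt_symm p).aemeasurable (isOpen_extChartAt_target p).measurableSet

end Measurability

section Volume

variable {n : ℕ} {M : Type*} [TopologicalSpace M] [ChartedSpace (EuclideanSpace ℝ (Fin n)) M]
  [IsManifold (𝓡 n) ∞ M] [Bundle.RiemannianBundle (fun x : M ↦ TangentSpace (𝓡 n) x)]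
  [MeasurableSpace M] [BorelSpace M]

local notation "𝔼" => EuclideanSpace ℝ (Fin n)

omit [IsManifold (𝓡 n) ∞ M] in
lemma aemeasurable_chart_symm_withDensity (p : M) : AEMeasurable (extChartAt (𝓡 n) p).symm
    (((volume : Measure 𝔼).restrict (extChartAt (𝓡 n) p).target).withDensity
      fun u ↦ ENNReal.ofReal (volumeDensity n p u)) :=
  (aemeasurable_chart_symm p).mono_ac (withDensity_absolutelyContinuous _ _)

omit [IsManifold (𝓡 n) ∞ M] in
lemma chartVolume_apply (p : M) {A : Set M} (hA : MeasurableSet A) :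
    chartVolume n p A = ∫⁻ u in (extChartAt (𝓡 n) p).target ∩ (extChartAt (𝓡 n) p).symm ⁻¹' A,
      ENNReal.ofReal (volumeDensity n p u) := by
  rw [chartVolume, Measure.map_apply_of_aemeasurable (aemeasurable_chart_symm_withDensity p) hA,
    withDensity_apply', Measure.restrict_restrict' (isOpen_extChartAt_target p).measurableSet,
    Set.inter_comm]

omit [IsManifold (𝓡 n) ∞ M] in
lemma chartVolume_compl_source (p : M) : chartVolume n p (extChartAt (𝓡 n) p).sourceᶜ = 0 := by
  rw [chartVolume_apply p (isOpen_extChartAt_source p).measurableSet.compl]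
  have : (extChartAt (𝓡 n) p).target ∩
      (extChartAt (𝓡 n) p).symm ⁻¹' (extChartAt (𝓡 n) p).sourceᶜ = ∅ :=
    Set.eq_empty_of_forall_notMem fun u hu ↦ hu.2 ((extChartAt (𝓡 n) p).map_target hu.1)
  rw [this, Measure.restrict_empty, lintegral_zero_measure]

/-- The chart volumes agree on overlaps, by the change of variables formula. -/
lemma chartVolume_apply_eq (p q : M) {A : Set M} (hA : MeasurableSet A)
    (hp : A ⊆ (extChartAt (𝓡 n) p).source) (hq : A ⊆ (extChartAt (𝓡 n) q).source) :
    chartVolume n p A = chartVolume n q A := by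
  set T := extChartAt (𝓡 n) q ∘ (extChartAt (𝓡 n) p).symm with hT
  rw [chartVolume_apply p hA, chartVolume_apply q hA,
    ← (extChartAt (𝓡 n) p).image_eq_target_inter_inv_preimage hp,
    ← (extChartAt (𝓡 n) q).image_eq_target_inter_inv_preimage hq]
  have himg : extChartAt (𝓡 n) q '' A = T '' (extChartAt (𝓡 n) p '' A) := by
    rw [Set.image_image]
    refine Set.image_congr fun x hx ↦ ?_
    simp only [hT, Function.comp_apply]
    rw [(extChartAt (𝓡 n) p).left_inv (hp hx)]
  have hmem : ∀ u ∈ extChartAt (𝓡 n) p '' A, u ∈ (extChartAt (𝓡 n) p).target ∧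
      (extChartAt (𝓡 n) p).symm u ∈ A := by
    rintro _ ⟨x, hx, rfl⟩
    refine ⟨(extChartAt (𝓡 n) p).map_source (hp hx), ?_⟩
    rwa [(extChartAt (𝓡 n) p).left_inv (hp hx)]
  have hinj : Set.InjOn T (extChartAt (𝓡 n) p '' A) := by
    intro u hu v hv huv
    have h1 := (extChartAt (𝓡 n) q).injOn (hq (hmem u hu).2) (hq (hmem v hv).2) huv
    exact (extChartAt (𝓡 n) p).symm.injOn (hmem u hu).1 (hmem v hv).1 h1
  rw [himg, lintegral_image_eq_lintegral_abs_det_fderiv_mul volume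
    (measurableSet_chart_image p hA hp) (fun u hu ↦ ((differentiableAt_chart_change (hmem u hu).1
      (hq (hmem u hu).2)).hasFDerivAt).hasFDerivWithinAt) hinj]
  refine setLIntegral_congr_fun (measurableSet_chart_image p hA hp) fun u hu ↦ ?_
  rw [volumeDensity_chart_change (hmem u hu).1 (hq (hmem u hu).2),
    ENNReal.ofReal_mul (abs_nonneg _)]

variable [CompactSpace M]

/-- Compactness enters through a countable cover by chart domains, which the gluing of compatible
measures requires. -/
lemma riemannianVolume_apply (p : M) {A : Set M} (hA : MeasurableSet A)
    (hp : A ⊆ (extChartAt (𝓡 n) p).source) : riemannianVolume n A = chartVolume n p A := by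
  obtain ⟨s, hs, hcov⟩ := countable_cover_nhds_of_sigmaCompact
    fun x : M ↦ extChartAt_source_mem_nhds (I := 𝓡 n) x
  have hne : s.Nonempty := by
    by_contra h
    rw [Set.not_nonempty_iff_eq_empty] at h
    simp only [h, Set.mem_empty_iff_false, Set.iUnion_of_empty, Set.iUnion_empty] at hcov
    exact (hcov.symm ▸ Set.mem_univ p : p ∈ (∅ : Set M))
  obtain ⟨f, rfl⟩ := hs.exists_eq_range hne
  refine iSup_measure_apply_of_compatible (U := fun p : M ↦ (extChartAt (𝓡 n) p).source)
    (fun q ↦ (isOpen_extChartAt_source q).measurableSet) (s := f) ?_ chartVolume_compl_source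
    (fun i j B hB hi hj ↦ chartVolume_apply_eq i j hB hi hj) hA hp
  rwa [Set.biUnion_range] at hcov

lemma riemannianVolume_restrict_source (p : M) :
    (riemannianVolume n).restrict (extChartAt (𝓡 n) p).source = chartVolume n p := by
  ext A hA
  rw [Measure.restrict_apply hA, riemannianVolume_apply p
    (hA.inter (isOpen_extChartAt_source p).measurableSet) Set.inter_subset_right]
  exact measure_inter_conull (chartVolume_compl_source p)

variable [IsContMDiffRiemannianBundle (𝓡 n) ∞ (EuclideanSpace ℝ (Fin n))
      (fun x : M ↦ TangentSpace (𝓡 n) x)]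

/-- The density is positive on each chart. Full support later upgrades almost everywhere equality of
continuous functions to equality. -/
instance isOpenPosMeasure_riemannianVolume :
    (riemannianVolume n : Measure M).IsOpenPosMeasure := by
  refine ⟨fun U hU ⟨x, hx⟩ h0 ↦ ?_⟩
  set W : Set 𝔼 := (extChartAt (𝓡 n) x).target ∩ (extChartAt (𝓡 n) x).symm ⁻¹' U with hW
  have hWo : IsOpen W := (continuousOn_extChartAt_symm x).isOpen_inter_preimage
    (isOpen_extChartAt_target x) hU
  have hWn : W.Nonempty := ⟨extChartAt (𝓡 n) x x, mem_extChartAt_target x, by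
    rw [Set.mem_preimage, extChartAt_to_inv]; exact hx⟩
  have h1 : chartVolume n x U = 0 := by
    have := Measure.le_iff'.1 (le_iSup (fun p : M ↦ chartVolume n p) x) U
    exact le_antisymm (this.trans_eq h0) bot_le
  rw [chartVolume_apply x hU.measurableSet, lintegral_eq_zero_iff'] at h1
  · have h2 : ∀ᵐ u ∂(volume.restrict W), False := by
      filter_upwards [h1, ae_restrict_mem hWo.measurableSet] with u hu huW
      exact absurd (ENNReal.ofReal_eq_zero.1 hu) (not_le.2 (volumeDensity_pos huW.1))
    rw [Filter.eventually_false_iff_eq_bot, ae_eq_bot, Measure.restrict_eq_zero] at h2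
    exact (hWo.measure_pos volume hWn).ne' h2
  · exact ((contDiffOn_volumeDensity x).continuousOn.mono Set.inter_subset_left).aemeasurable
      hWo.measurableSet |>.ennreal_ofReal

/-- Integrals over a chart domain, computed in the chart. -/
lemma setIntegral_riemannianVolume (p : M) {F : M → ℝ}
    (hF : ContinuousOn F (extChartAt (𝓡 n) p).source) :
    ∫ x in (extChartAt (𝓡 n) p).source, F x ∂(riemannianVolume n) =
      ∫ u in (extChartAt (𝓡 n) p).target,
        volumeDensity n p u * F ((extChartAt (𝓡 n) p).symm u) := by
  have hm : AEStronglyMeasurable F (chartVolume n p) := by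
    rw [← riemannianVolume_restrict_source]
    have := (secondCountableTopologyEither_of_right M ℝ)
    exact hF.aestronglyMeasurable (isOpen_extChartAt_source p).measurableSet
  rw [riemannianVolume_restrict_source, chartVolume,
    integral_map (aemeasurable_chart_symm_withDensity p) hm,
    integral_withDensity_eq_integral_toReal_smul₀]
  · refine setIntegral_congr_fun (isOpen_extChartAt_target p).measurableSet fun u hu ↦ ?_
    simp only [smul_eq_mul]
    rw [ENNReal.toReal_ofReal (volumeDensity_pos hu).le]
  · exact ((contDiffOn_volumeDensity p).continuousOn.aemeasurable
      (isOpen_extChartAt_target p).measurableSet).ennreal_ofReal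
  · exact Filter.Eventually.of_forall fun u ↦ ENNReal.ofReal_lt_top

end Volume

/-! ### Integration by parts in Euclidean space -/

section Euclidean

variable {n : ℕ}

local notation "𝔼" => EuclideanSpace ℝ (Fin n)

/-- Outside `U` the factor `G` is uncontrolled, but there `W` vanishes locally. Chart expressions
carry no information outside the chart target. -/
lemma continuous_mul_of_tsupport_subset {X : Type*} [TopologicalSpace X] {U : Set X}
    (hU : IsOpen U) {W G : X → ℝ} (hW : Continuous W) (hs : tsupport W ⊆ U)
    (hG : ContinuousOn G U) : Continuous fun u ↦ W u * G u := by
  refine continuous_of_tsupport fun x hx ↦ ?_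
  have hx' : x ∈ U := hs (tsupport_mul_subset_left hx)
  exact hW.continuousAt.mul (hG.continuousAt (hU.mem_nhds hx'))

lemma integrable_mul_of_tsupport_subset {U : Set 𝔼} (hU : IsOpen U) {W G : 𝔼 → ℝ}
    (hW : Continuous W) (hc : HasCompactSupport W) (hs : tsupport W ⊆ U)
    (hG : ContinuousOn G U) : Integrable fun u ↦ W u * G u :=
  (continuous_mul_of_tsupport_subset hU hW hs hG).integrable_of_hasCompactSupport hc.mul_right

lemma tsupport_partialDeriv_subset (W : 𝔼 → ℝ) (i : Fin n) :
    tsupport (partialDeriv i W) ⊆ tsupport W :=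
  tsupport_fderiv_apply_subset ℝ _

/-- Integration by parts against a compactly supported function. -/
lemma integral_mul_sum_partialDeriv {U : Set 𝔼} (hU : IsOpen U) {W : 𝔼 → ℝ}
    (hW : ContDiff ℝ ∞ W) (hc : HasCompactSupport W) (hs : tsupport W ⊆ U)
    {F : Fin n → 𝔼 → ℝ} (hF : ∀ i, ContDiffOn ℝ ∞ (F i) U) :
    ∫ u, W u * ∑ i, partialDeriv i (F i) u = -∫ u, ∑ i, partialDeriv i W u * F i u := by
  have hdW : ∀ i, Continuous (partialDeriv i W) := fun i ↦
    (hW.continuous_fderiv (by simp)).clm_apply continuous_const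
  have h1 : ∀ i, Integrable fun u ↦ W u * partialDeriv i (F i) u := fun i ↦
    integrable_mul_of_tsupport_subset hU hW.continuous hc hs ((hF i).partialDeriv hU i).continuousOn
  have h2 : ∀ i, Integrable fun u ↦ partialDeriv i W u * F i u := fun i ↦
    integrable_mul_of_tsupport_subset hU (hdW i) (hc.fderiv_apply (𝕜 := ℝ) _)
      ((tsupport_partialDeriv_subset W i).trans hs) (hF i).continuousOn
  have h3 : ∀ i, Integrable fun u ↦ W u * F i u := fun i ↦
    integrable_mul_of_tsupport_subset hU hW.continuous hc hs (hF i).continuousOn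
  simp only [Finset.mul_sum]
  rw [integral_finsetSum _ fun i _ ↦ h1 i, integral_finsetSum _ fun i _ ↦ h2 i,
    ← Finset.sum_neg_distrib]
  refine Finset.sum_congr rfl fun i _ ↦ ?_
  refine integral_mul_fderiv_eq_neg_fderiv_mul_of_integrable (h2 i) (h1 i) (h3 i)
    (fun x _ ↦ (hW.differentiable (by simp)).differentiableAt) fun x hx ↦ ?_
  exact ((hF i).contDiffAt (hU.mem_nhds (hs hx))).differentiableAt (by simp)

end Euclidean

/-! ### The Laplacian in a fixed chart -/

section ChartLaplacian

variable {n : ℕ} {M : Type*} [TopologicalSpace M] [ChartedSpace (EuclideanSpace ℝ (Fin n)) M]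
  [IsManifold (𝓡 n) ∞ M] [Bundle.RiemannianBundle (fun x : M ↦ TangentSpace (𝓡 n) x)]

local notation "𝔼" => EuclideanSpace ℝ (Fin n)

/-- The components `√g ∑ⱼ gⁱʲ ∂ⱼh` of the densitized gradient in the preferred chart at `p`. -/
def chartFlux (p : M) (h : M → ℝ) (i : Fin n) (u : 𝔼) : ℝ :=
  volumeDensity n p u *
    ∑ j, (metricMatrix n p u)⁻¹ i j * partialDeriv j (h ∘ (extChartAt (𝓡 n) p).symm) u

/-- The Laplace–Beltrami operator in the preferred chart at `p`. -/
def chartLaplacian (p : M) (h : M → ℝ) (u : 𝔼) : ℝ :=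
  (volumeDensity n p u)⁻¹ * ∑ i, partialDeriv i (chartFlux p h i) u

omit [IsManifold (𝓡 n) ∞ M] in
lemma laplaceBeltrami_eq_chartLaplacian (h : M → ℝ) (x : M) :
    laplaceBeltrami n h x = chartLaplacian x h (extChartAt (𝓡 n) x x) := rfl

variable [IsContMDiffRiemannianBundle (𝓡 n) ∞ (EuclideanSpace ℝ (Fin n))
      (fun x : M ↦ TangentSpace (𝓡 n) x)] {h : M → ℝ} (hh : ContMDiff (𝓡 n) 𝓘(ℝ, ℝ) ∞ h)
include hh

lemma contDiffOn_chartFlux (p : M) (i : Fin n) :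
    ContDiffOn ℝ ∞ (chartFlux p h i) (extChartAt (𝓡 n) p).target :=
  (contDiffOn_volumeDensity p).mul <| ContDiffOn.sum fun j _ ↦
    (contDiffOn_metricMatrix_inv p i j).mul
      ((contDiffOn_comp_chart_symm hh p).partialDeriv (isOpen_extChartAt_target p) j)

lemma contDiffOn_chartLaplacian (p : M) :
    ContDiffOn ℝ ∞ (chartLaplacian p h) (extChartAt (𝓡 n) p).target :=
  ((contDiffOn_volumeDensity p).inv fun _ hu ↦ (volumeDensity_pos hu).ne').mul <|
    ContDiffOn.sum fun i _ ↦
      (contDiffOn_chartFlux hh p i).partialDeriv (isOpen_extChartAt_target p) i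

lemma contMDiffOn_chartLaplacian (p : M) :
    ContMDiffOn (𝓡 n) 𝓘(ℝ, ℝ) ∞ (fun x ↦ chartLaplacian p h (extChartAt (𝓡 n) p x))
      (extChartAt (𝓡 n) p).source :=
  (contDiffOn_chartLaplacian hh p).contMDiffOn.comp
    (by rw [extChartAt_source]; exact contMDiffOn_extChartAt)
    fun _ hx ↦ (extChartAt (𝓡 n) p).map_source hx

omit [IsContMDiffRiemannianBundle (𝓡 n) ∞ (EuclideanSpace ℝ (Fin n))
      (fun x : M ↦ TangentSpace (𝓡 n) x)] in
lemma volumeDensity_mul_inner_gradient {w : M → ℝ} (hw : ContMDiff (𝓡 n) 𝓘(ℝ, ℝ) ∞ w) {p : M}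
    {u : 𝔼} (hu : u ∈ (extChartAt (𝓡 n) p).target) :
    volumeDensity n p u * inner ℝ (gradient n w ((extChartAt (𝓡 n) p).symm u))
        (gradient n h ((extChartAt (𝓡 n) p).symm u)) =
      ∑ i, partialDeriv i (w ∘ (extChartAt (𝓡 n) p).symm) u * chartFlux p h i u := by
  rw [inner_gradient_eq_sum hu (hw.mdifferentiable (by simp) _) (hh.mdifferentiable (by simp) _),
    Finset.mul_sum]
  refine Finset.sum_congr rfl fun i _ ↦ ?_
  rw [chartFlux, Finset.mul_sum, Finset.mul_sum, Finset.mul_sum]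
  exact Finset.sum_congr rfl fun j _ ↦ by ring

/-- The pairing of gradients of smooth functions is smooth. -/
lemma contMDiff_inner_gradient {w : M → ℝ} (hw : ContMDiff (𝓡 n) 𝓘(ℝ, ℝ) ∞ w) :
    ContMDiff (𝓡 n) 𝓘(ℝ, ℝ) ∞ fun x ↦ inner ℝ (gradient n w x) (gradient n h x) := by
  intro p
  have h1 : ContDiffOn ℝ ∞ (fun u ↦ ∑ i, ∑ j, (metricMatrix n p u)⁻¹ i j *
      partialDeriv i (w ∘ (extChartAt (𝓡 n) p).symm) u *
        partialDeriv j (h ∘ (extChartAt (𝓡 n) p).symm) u) (extChartAt (𝓡 n) p).target :=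
    ContDiffOn.sum fun i _ ↦ ContDiffOn.sum fun j _ ↦
      ((contDiffOn_metricMatrix_inv p i j).mul
        ((contDiffOn_comp_chart_symm hw p).partialDeriv (isOpen_extChartAt_target p) i)).mul
        ((contDiffOn_comp_chart_symm hh p).partialDeriv (isOpen_extChartAt_target p) j)
  have h2 := h1.contMDiffOn.comp
    (by rw [extChartAt_source]; exact contMDiffOn_extChartAt (I := 𝓡 n) (x := p))
    fun _ hx ↦ (extChartAt (𝓡 n) p).map_source hx
  refine (h2.congr fun x hx ↦ ?_).contMDiffAt (extChartAt_source_mem_nhds p)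
  have := inner_gradient_eq_sum (u := extChartAt (𝓡 n) p x) ((extChartAt (𝓡 n) p).map_source hx)
    (hw.mdifferentiable (by simp) _) (hh.mdifferentiable (by simp) _)
  rw [(extChartAt (𝓡 n) p).left_inv hx] at this
  exact this

end ChartLaplacian

section LocalParts

variable {n : ℕ} {M : Type*} [TopologicalSpace M] [ChartedSpace (EuclideanSpace ℝ (Fin n)) M]
  [IsManifold (𝓡 n) ∞ M] [CompactSpace M]

local notation "𝔼" => EuclideanSpace ℝ (Fin n)

/-- A smooth function supported in a chart domain, read in the chart and extended by zero. -/
lemma contDiff_indicator_comp_chart_symm [T2Space M] {w : M → ℝ}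
    (hw : ContMDiff (𝓡 n) 𝓘(ℝ, ℝ) ∞ w) {p : M} (hs : tsupport w ⊆ (extChartAt (𝓡 n) p).source) :
    HasCompactSupport ((extChartAt (𝓡 n) p).target.indicator (w ∘ (extChartAt (𝓡 n) p).symm)) ∧
    tsupport ((extChartAt (𝓡 n) p).target.indicator (w ∘ (extChartAt (𝓡 n) p).symm)) ⊆
      (extChartAt (𝓡 n) p).target ∧
    ContDiff ℝ ∞ ((extChartAt (𝓡 n) p).target.indicator (w ∘ (extChartAt (𝓡 n) p).symm)) := by
  set K : Set 𝔼 := extChartAt (𝓡 n) p '' tsupport w with hK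
  have hKc : IsCompact K := (isClosed_tsupport w).isCompact.image_of_continuousOn
    ((continuousOn_extChartAt p).mono hs)
  have hKt : K ⊆ (extChartAt (𝓡 n) p).target := by
    rintro _ ⟨x, hx, rfl⟩
    exact (extChartAt (𝓡 n) p).map_source (hs hx)
  have hsub : tsupport ((extChartAt (𝓡 n) p).target.indicator
      (w ∘ (extChartAt (𝓡 n) p).symm)) ⊆ K := by
    refine closure_minimal (fun u hu ↦ ?_) hKc.isClosed
    have hut := Set.mem_of_indicator_ne_zero hu
    rw [Function.mem_support, Set.indicator_of_mem hut] at hu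
    exact ⟨_, subset_tsupport w hu, (extChartAt (𝓡 n) p).right_inv hut⟩
  refine ⟨hKc.of_isClosed_subset (isClosed_tsupport _) hsub, hsub.trans hKt,
    (contMDiff_of_tsupport fun u hu ↦ ContDiffAt.contMDiffAt ?_).contDiff⟩
  have hnhds := (isOpen_extChartAt_target p).mem_nhds (hKt (hsub hu))
  refine ((contDiffOn_comp_chart_symm hw p).contDiffAt hnhds).congr_of_eventuallyEq ?_
  filter_upwards [hnhds] with v hv
  rw [Set.indicator_of_mem hv]

end LocalParts

lemma gradient_eq_zero_of_notMem_tsupport {n : ℕ} {M : Type*} [TopologicalSpace M]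
    [ChartedSpace (EuclideanSpace ℝ (Fin n)) M]
    [Bundle.RiemannianBundle (fun x : M ↦ TangentSpace (𝓡 n) x)] {w : M → ℝ} {x : M}
    (hx : x ∉ tsupport w) : gradient n w x = 0 := by
  have h0 : w =ᶠ[nhds x] fun _ ↦ 0 := notMem_tsupport_iff_eventuallyEq.1 hx
  have h1 : mfderiv (𝓡 n) 𝓘(ℝ, ℝ) w x = 0 := h0.mfderiv_eq.trans mfderiv_const
  refine ext_inner_right ℝ fun v ↦ ?_
  rw [inner_gradient_left, h1, inner_zero_left]
  rfl

/-! ### Weak form of the Laplacian and chart independence -/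

section Parts

variable {n : ℕ} {M : Type*} [TopologicalSpace M] [T2Space M] [CompactSpace M]
  [ChartedSpace (EuclideanSpace ℝ (Fin n)) M] [IsManifold (𝓡 n) ∞ M]
  [Bundle.RiemannianBundle (fun x : M ↦ TangentSpace (𝓡 n) x)]
  [IsContMDiffRiemannianBundle (𝓡 n) ∞ (EuclideanSpace ℝ (Fin n))
    (fun x : M ↦ TangentSpace (𝓡 n) x)]
  [MeasurableSpace M] [BorelSpace M]

local notation "𝔼" => EuclideanSpace ℝ (Fin n)

/-- Integration by parts for the Laplacian of a chart. -/
lemma integral_mul_chartLaplacian {w h : M → ℝ} (hw : ContMDiff (𝓡 n) 𝓘(ℝ, ℝ) ∞ w)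
    (hh : ContMDiff (𝓡 n) 𝓘(ℝ, ℝ) ∞ h) {p : M}
    (hs : tsupport w ⊆ (extChartAt (𝓡 n) p).source) :
    ∫ x, w x * chartLaplacian p h (extChartAt (𝓡 n) p x) ∂(riemannianVolume n) =
      -∫ x, inner ℝ (gradient n w x) (gradient n h x) ∂(riemannianVolume n) := by
  obtain ⟨hc, hsupp, hsmooth⟩ := contDiff_indicator_comp_chart_symm hw hs
  set W := (extChartAt (𝓡 n) p).target.indicator (w ∘ (extChartAt (𝓡 n) p).symm) with hW
  have hUo := isOpen_extChartAt_target (I := 𝓡 n) p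
  rw [← setIntegral_eq_integral_of_forall_compl_eq_zero (s := (extChartAt (𝓡 n) p).source),
    ← setIntegral_eq_integral_of_forall_compl_eq_zero (s := (extChartAt (𝓡 n) p).source)
      (f := fun x ↦ inner ℝ (gradient n w x) (gradient n h x)),
    setIntegral_riemannianVolume, setIntegral_riemannianVolume]
  -- The volume density cancels the inverse density in front of the divergence.
  · have h1 : ∀ u ∈ (extChartAt (𝓡 n) p).target,
        volumeDensity n p u * (w ((extChartAt (𝓡 n) p).symm u) *
          chartLaplacian p h (extChartAt (𝓡 n) p ((extChartAt (𝓡 n) p).symm u))) =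
        W u * ∑ i, partialDeriv i (chartFlux p h i) u := fun u hu ↦ by
      rw [(extChartAt (𝓡 n) p).right_inv hu, hW, Set.indicator_of_mem hu, chartLaplacian,
        Function.comp_apply]
      field_simp [(volumeDensity_pos hu).ne']
    have h2 : ∀ u ∈ (extChartAt (𝓡 n) p).target,
        volumeDensity n p u * inner ℝ (gradient n w ((extChartAt (𝓡 n) p).symm u))
          (gradient n h ((extChartAt (𝓡 n) p).symm u)) =
        ∑ i, partialDeriv i W u * chartFlux p h i u := fun u hu ↦ by
      have hev : W =ᶠ[nhds u] w ∘ (extChartAt (𝓡 n) p).symm := by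
        filter_upwards [hUo.mem_nhds hu] with v hv
        rw [hW, Set.indicator_of_mem hv]
      rw [volumeDensity_mul_inner_gradient hh hw hu]
      simp only [partialDeriv, hev.fderiv_eq]
    rw [setIntegral_congr_fun hUo.measurableSet h1, setIntegral_congr_fun hUo.measurableSet h2,
      setIntegral_eq_integral_of_forall_compl_eq_zero,
      setIntegral_eq_integral_of_forall_compl_eq_zero]
    · exact integral_mul_sum_partialDeriv hUo hsmooth hc hsupp fun i ↦ contDiffOn_chartFlux hh p i
    · intro u hu
      refine Finset.sum_eq_zero fun i _ ↦ ?_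
      rw [image_eq_zero_of_notMem_tsupport fun hu' ↦
        hu (hsupp (tsupport_partialDeriv_subset W i hu')), zero_mul]
    · intro u hu
      rw [hW, Set.indicator_of_notMem hu, zero_mul]
  · exact (contMDiff_inner_gradient hh hw).continuous.continuousOn
  · exact hw.continuous.continuousOn.mul (contMDiffOn_chartLaplacian hh p).continuousOn
  · intro x hx
    rw [gradient_eq_zero_of_notMem_tsupport fun hx' ↦ hx (hs hx'), inner_zero_left]
  · intro x hx
    rw [image_eq_zero_of_notMem_tsupport fun hx' ↦ hx (hs hx'), zero_mul]

variable [IsFiniteMeasure (riemannianVolume n : Measure M)]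

omit [T2Space M] [IsManifold (𝓡 n) ∞ M]
  [IsContMDiffRiemannianBundle (𝓡 n) ∞ (EuclideanSpace ℝ (Fin n))
    (fun x : M ↦ TangentSpace (𝓡 n) x)] in
lemma integrable_riemannianVolume_of_continuous {F : M → ℝ} (hF : Continuous F) :
    Integrable F (riemannianVolume n) :=
  hF.integrable_of_hasCompactSupport (HasCompactSupport.of_compactSpace F)

/-- Two functions that are continuous on an open set agree there if they have the same
integrals against test functions. -/
lemma eqOn_of_integral_mul_eq {F G : M → ℝ} {U : Set M} (hU : IsOpen U) (hF : ContinuousOn F U)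
    (hG : ContinuousOn G U)
    (hFG : ∀ w : M → ℝ, ContMDiff (𝓡 n) 𝓘(ℝ, ℝ) ∞ w → tsupport w ⊆ U →
      ∫ x, w x * F x ∂(riemannianVolume n) = ∫ x, w x * G x ∂(riemannianVolume n)) :
    Set.EqOn F G U := by
  have : SecondCountableTopology M := ChartedSpace.secondCountable_of_sigmaCompact 𝔼 M
  have : T3Space M := inferInstance
  have hint : ∀ {H : M → ℝ} {w : M → ℝ}, ContinuousOn H U → ContMDiff (𝓡 n) 𝓘(ℝ, ℝ) ∞ w →
      tsupport w ⊆ U → Integrable (fun x ↦ w x * H x) (riemannianVolume n) := fun hH hw hs ↦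
    integrable_riemannianVolume_of_continuous
      (continuous_mul_of_tsupport_subset hU hw.continuous hs hH)
  have hae := hU.ae_eq_zero_of_integral_contMDiff_smul_eq_zero (𝓡 n) (f := fun x ↦ F x - G x)
    (μ := riemannianVolume n) ((hF.sub hG).locallyIntegrableOn hU.measurableSet)
    fun w hw _ hs ↦ by
      simp only [smul_eq_mul, mul_sub]
      rw [integral_sub (hint hF hw hs) (hint hG hw hs), hFG w hw hs, sub_self]
  refine Measure.eqOn_open_of_ae_eq (μ := riemannianVolume n) ?_ hU hF hG
  rw [Filter.EventuallyEq, ae_restrict_iff' hU.measurableSet]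
  filter_upwards [hae] with x hx hxU using sub_eq_zero.1 (hx hxU)

/-- The Laplacian may be computed in any chart. -/
lemma laplaceBeltrami_eq_chartLaplacian_of_mem {h : M → ℝ} (hh : ContMDiff (𝓡 n) 𝓘(ℝ, ℝ) ∞ h)
    {p x : M} (hx : x ∈ (extChartAt (𝓡 n) p).source) :
    laplaceBeltrami n h x = chartLaplacian p h (extChartAt (𝓡 n) p x) := by
  -- Freeze the chart at `x`: both sides become fixed-chart Laplacians, continuous on the overlap
  -- and with the same weak form.
  rw [laplaceBeltrami_eq_chartLaplacian]
  refine eqOn_of_integral_mul_eq (n := n) (F := fun y ↦ chartLaplacian x h (extChartAt (𝓡 n) x y))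
    (G := fun y ↦ chartLaplacian p h (extChartAt (𝓡 n) p y))
    ((isOpen_extChartAt_source x).inter (isOpen_extChartAt_source (I := 𝓡 n) p))
    ((contMDiffOn_chartLaplacian hh x).continuousOn.mono Set.inter_subset_left)
    ((contMDiffOn_chartLaplacian hh p).continuousOn.mono Set.inter_subset_right)
    (fun w hw hs ↦ ?_) ⟨mem_extChartAt_source x, hx⟩
  rw [integral_mul_chartLaplacian hw hh (hs.trans Set.inter_subset_left),
    integral_mul_chartLaplacian hw hh (hs.trans Set.inter_subset_right)]

/-- The chart in the definition moves with the point; near `p` all values can be read in the single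
chart at `p`. -/
lemma contMDiff_laplaceBeltrami {h : M → ℝ} (hh : ContMDiff (𝓡 n) 𝓘(ℝ, ℝ) ∞ h) :
    ContMDiff (𝓡 n) 𝓘(ℝ, ℝ) ∞ (laplaceBeltrami n h) := fun p ↦
  ((contMDiffOn_chartLaplacian hh p).congr fun _ hx ↦
    laplaceBeltrami_eq_chartLaplacian_of_mem hh hx).contMDiffAt (extChartAt_source_mem_nhds p)

end Parts

/-! ### Calculus of gradients -/

section Gradient

variable {n : ℕ} {M : Type*} [TopologicalSpace M] [ChartedSpace (EuclideanSpace ℝ (Fin n)) M]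
  [Bundle.RiemannianBundle (fun x : M ↦ TangentSpace (𝓡 n) x)] {f g : M → ℝ} {x : M}

lemma gradient_mul (hf : MDifferentiableAt (𝓡 n) 𝓘(ℝ, ℝ) f x)
    (hg : MDifferentiableAt (𝓡 n) 𝓘(ℝ, ℝ) g x) :
    gradient n (fun y ↦ f y * g y) x = f x • gradient n g x + g x • gradient n f x := by
  refine ext_inner_right ℝ fun v ↦ ?_
  rw [inner_add_left, inner_smul_left, inner_smul_left, inner_gradient_left, inner_gradient_left,
    inner_gradient_left]
  have := (hf.hasMFDerivAt.mul hg.hasMFDerivAt).mfderiv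
  have h2 : mfderiv (𝓡 n) 𝓘(ℝ, ℝ) (fun y ↦ f y * g y) x =
    mfderiv (𝓡 n) 𝓘(ℝ, ℝ) (f * g) x := rfl
  rw [h2, this]
  rfl

end Gradient

section Gradient

variable {n : ℕ} {M : Type*} [TopologicalSpace M] [ChartedSpace (EuclideanSpace ℝ (Fin n)) M]
  [Bundle.RiemannianBundle (fun x : M ↦ TangentSpace (𝓡 n) x)] {f g : M → ℝ} {x : M}

lemma gradient_add (hf : MDifferentiableAt (𝓡 n) 𝓘(ℝ, ℝ) f x)
    (hg : MDifferentiableAt (𝓡 n) 𝓘(ℝ, ℝ) g x) :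
    gradient n (fun y ↦ f y + g y) x = gradient n f x + gradient n g x := by
  refine ext_inner_right ℝ fun v ↦ ?_
  rw [inner_add_left, inner_gradient_left, inner_gradient_left, inner_gradient_left]
  have := (hf.hasMFDerivAt.add hg.hasMFDerivAt).mfderiv
  have h2 : mfderiv (𝓡 n) 𝓘(ℝ, ℝ) (fun y ↦ f y + g y) x =
    mfderiv (𝓡 n) 𝓘(ℝ, ℝ) (f + g) x := rfl
  rw [h2, this]
  rfl

/-- The chain rule for gradients, with a one-sided derivative at the end points of `J`. -/
lemma gradient_comp {J : Set ℝ} {φ : ℝ → ℝ} {φ' : ℝ} (hφ : HasDerivWithinAt φ φ' J (f x))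
    (hfJ : ∀ y, f y ∈ J) (hf : MDifferentiableAt (𝓡 n) 𝓘(ℝ, ℝ) f x) :
    gradient n (fun y ↦ φ (f y)) x = φ' • gradient n f x := by
  refine ext_inner_right ℝ fun v ↦ ?_
  rw [inner_smul_left, inner_gradient_left, inner_gradient_left]
  -- Because `f` maps all of `M` into `J`, a derivative within `J` suffices for the composite to be
  -- differentiable in the full sense.
  have h1 := hφ.hasFDerivWithinAt.hasMFDerivWithinAt.comp x hf.hasMFDerivAt.hasMFDerivWithinAt
    (s := Set.univ) fun y _ ↦ hfJ y
  rw [hasMFDerivWithinAt_univ] at h1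
  have h2 : mfderiv (𝓡 n) 𝓘(ℝ, ℝ) (fun y ↦ φ (f y)) x =
    mfderiv (𝓡 n) 𝓘(ℝ, ℝ) (φ ∘ f) x := rfl
  rw [h2, h1.mfderiv]
  exact mul_comm (G := ℝ) _ _

end Gradient

/-! ### Green's formula, the operator `L` and its carré du champ -/

section Global

variable {n : ℕ} {M : Type*} [TopologicalSpace M] [T2Space M] [CompactSpace M]
  [ChartedSpace (EuclideanSpace ℝ (Fin n)) M] [IsManifold (𝓡 n) ∞ M]
  [Bundle.RiemannianBundle (fun x : M ↦ TangentSpace (𝓡 n) x)]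
  [IsContMDiffRiemannianBundle (𝓡 n) ∞ (EuclideanSpace ℝ (Fin n))
    (fun x : M ↦ TangentSpace (𝓡 n) x)]
  [MeasurableSpace M] [BorelSpace M]

section Laplacian

variable [IsFiniteMeasure (riemannianVolume n : Measure M)]

/-- Integration by parts for the Laplace–Beltrami operator. -/
lemma integral_mul_laplaceBeltrami {w h : M → ℝ} (hw : ContMDiff (𝓡 n) 𝓘(ℝ, ℝ) ∞ w)
    (hh : ContMDiff (𝓡 n) 𝓘(ℝ, ℝ) ∞ h) :
    ∫ x, w x * laplaceBeltrami n h x ∂(riemannianVolume n) =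
      -∫ x, inner ℝ (gradient n w x) (gradient n h x) ∂(riemannianVolume n) := by
  obtain ⟨ρ, hρ⟩ := SmoothPartitionOfUnity.exists_isSubordinate_chartAt_source (𝓡 n) M
  have hfin : {i | (Function.support (ρ i)).Nonempty}.Finite :=
    ρ.locallyFinite.finite_nonempty_of_compact
  have hsum : ∀ x, ∑ i ∈ hfin.toFinset, ρ i x * w x = w x := fun x ↦ by
    rw [← Finset.sum_mul, ← finsum_eq_sum_of_support_subset, ρ.sum_eq_one (Set.mem_univ x),
      one_mul]
    intro i hi
    rw [Set.Finite.coe_toFinset]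
    exact ⟨x, hi⟩
  have hρw : ∀ i, ContMDiff (𝓡 n) 𝓘(ℝ, ℝ) ∞ fun x ↦ ρ i x * w x := fun i ↦
    (ρ i).contMDiff.mul hw
  have hlap := (contMDiff_laplaceBeltrami hh).continuous
  -- By compactness finitely many bump functions suffice; induction over them needs only binary
  -- additivity of both sides.
  have key : ∀ s : Finset M, ContMDiff (𝓡 n) 𝓘(ℝ, ℝ) ∞ (fun x ↦ ∑ i ∈ s, ρ i x * w x) ∧
      ∫ x, (∑ i ∈ s, ρ i x * w x) * laplaceBeltrami n h x ∂(riemannianVolume n) =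
      -∫ x, inner ℝ (gradient n (fun x ↦ ∑ i ∈ s, ρ i x * w x) x) (gradient n h x)
        ∂(riemannianVolume n) := by
    classical
    intro s
    induction s using Finset.induction_on with
    | empty =>
      refine ⟨by simpa using contMDiff_const, ?_⟩
      have : ∀ x : M, gradient n (fun _ : M ↦ (0 : ℝ)) x = 0 := fun x ↦
        gradient_eq_zero_of_notMem_tsupport (by simp [tsupport])
      simp [this]
    | insert a s ha ih =>
      simp only [Finset.sum_insert ha]
      refine ⟨(hρw a).add ih.1, ?_⟩
      have hsupp : tsupport (fun x ↦ ρ a x * w x) ⊆ (extChartAt (𝓡 n) a).source := by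
        rw [extChartAt_source]
        exact tsupport_mul_subset_left.trans (hρ a)
      have h1 : ∫ x, (ρ a x * w x) * laplaceBeltrami n h x ∂(riemannianVolume n) =
          -∫ x, inner ℝ (gradient n (fun x ↦ ρ a x * w x) x) (gradient n h x)
            ∂(riemannianVolume n) := by
        rw [← integral_mul_chartLaplacian (hρw a) hh hsupp]
        congr 1
        funext x
        by_cases hx : x ∈ (extChartAt (𝓡 n) a).source
        · rw [laplaceBeltrami_eq_chartLaplacian_of_mem hh hx]
        · rw [image_eq_zero_of_notMem_tsupport fun hx' ↦ hx (hsupp hx'), zero_mul, zero_mul]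
      have h2 : ∀ x, inner ℝ (gradient n (fun x ↦ ρ a x * w x + ∑ i ∈ s, ρ i x * w x) x)
          (gradient n h x) = inner ℝ (gradient n (fun x ↦ ρ a x * w x) x) (gradient n h x) +
          inner ℝ (gradient n (fun x ↦ ∑ i ∈ s, ρ i x * w x) x) (gradient n h x) := fun x ↦ by
        rw [gradient_add ((hρw a).mdifferentiable (by simp) x) (ih.1.mdifferentiable (by simp) x),
          inner_add_left]
      simp only [h2, add_mul]
      rw [integral_add, integral_add, h1, ih.2, neg_add]
      · exact integrable_riemannianVolume_of_continuous
          (contMDiff_inner_gradient hh (hρw a)).continuous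
      · exact integrable_riemannianVolume_of_continuous
          (contMDiff_inner_gradient hh ih.1).continuous
      · exact integrable_riemannianVolume_of_continuous ((hρw a).continuous.mul hlap)
      · exact integrable_riemannianVolume_of_continuous (ih.1.continuous.mul hlap)
  have := (key hfin.toFinset).2
  simp only [hsum] at this
  exact this

/-- `Δ(fg) = f Δg + g Δf + 2 ⟪∇f, ∇g⟫`. -/
lemma laplaceBeltrami_mul {f g : M → ℝ} (hf : ContMDiff (𝓡 n) 𝓘(ℝ, ℝ) ∞ f)
    (hg : ContMDiff (𝓡 n) 𝓘(ℝ, ℝ) ∞ g) (x : M) :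
    laplaceBeltrami n (fun y ↦ f y * g y) x = f x * laplaceBeltrami n g x +
      g x * laplaceBeltrami n f x + 2 * inner ℝ (gradient n f x) (gradient n g x) := by
  have hfg : ContMDiff (𝓡 n) 𝓘(ℝ, ℝ) ∞ fun y ↦ f y * g y := hf.mul hg
  have cf := contMDiff_laplaceBeltrami hf
  have cg := contMDiff_laplaceBeltrami hg
  have cfg := contMDiff_laplaceBeltrami hfg
  -- Test against `w`: Green's formula for the pairs `(w, fg)`, `(wf, g)`, `(wg, f)` reduces the
  -- claim to the first-order product rule `hpt`.
  refine eqOn_of_integral_mul_eq (n := n) (F := laplaceBeltrami n fun y ↦ f y * g y)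
    (G := fun x ↦ f x * laplaceBeltrami n g x +
      g x * laplaceBeltrami n f x + 2 * inner ℝ (gradient n f x) (gradient n g x))
    isOpen_univ cfg.continuous.continuousOn
    (((hf.continuous.mul cg.continuous).add (hg.continuous.mul cf.continuous)).add
      (continuous_const.mul (contMDiff_inner_gradient hg hf).continuous)).continuousOn
    (fun w hw _ ↦ ?_) (Set.mem_univ x)
  have hwf : ContMDiff (𝓡 n) 𝓘(ℝ, ℝ) ∞ fun y ↦ w y * f y := hw.mul hf
  have hwg : ContMDiff (𝓡 n) 𝓘(ℝ, ℝ) ∞ fun y ↦ w y * g y := hw.mul hg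
  have e1 := integral_mul_laplaceBeltrami hw hfg
  have e2 := integral_mul_laplaceBeltrami hwf hg
  have e3 := integral_mul_laplaceBeltrami hwg hf
  have i1 : Integrable (fun x ↦ w x * f x * laplaceBeltrami n g x) (riemannianVolume n) :=
    integrable_riemannianVolume_of_continuous (hwf.continuous.mul cg.continuous)
  have i2 : Integrable (fun x ↦ w x * g x * laplaceBeltrami n f x) (riemannianVolume n) :=
    integrable_riemannianVolume_of_continuous (hwg.continuous.mul cf.continuous)
  have i3 : Integrable (fun x ↦ 2 * (w x * inner ℝ (gradient n f x) (gradient n g x)))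
      (riemannianVolume n) := integrable_riemannianVolume_of_continuous
    (continuous_const.mul (hw.continuous.mul (contMDiff_inner_gradient hg hf).continuous))
  have j2 := integrable_riemannianVolume_of_continuous (n := n)
    (contMDiff_inner_gradient hg hwf).continuous
  have j3 := integrable_riemannianVolume_of_continuous (n := n)
    (contMDiff_inner_gradient hf hwg).continuous
  have hpt : ∀ x, inner ℝ (gradient n w x) (gradient n (fun y ↦ f y * g y) x) =
      inner ℝ (gradient n (fun y ↦ w y * f y) x) (gradient n g x) +
      inner ℝ (gradient n (fun y ↦ w y * g y) x) (gradient n f x) -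
      2 * (w x * inner ℝ (gradient n f x) (gradient n g x)) := fun x ↦ by
    have df := hf.mdifferentiable (by simp) x
    have dg := hg.mdifferentiable (by simp) x
    have dw := hw.mdifferentiable (by simp) x
    rw [gradient_mul df dg, gradient_mul dw df, gradient_mul dw dg]
    simp only [inner_add_left, inner_add_right, inner_smul_left, inner_smul_right, conj_trivial]
    rw [real_inner_comm (gradient n f x) (gradient n g x)]
    ring
  have hlhs : ∫ x, w x * (f x * laplaceBeltrami n g x + g x * laplaceBeltrami n f x +
        2 * inner ℝ (gradient n f x) (gradient n g x)) ∂(riemannianVolume n) =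
      ∫ x, (w x * f x * laplaceBeltrami n g x + w x * g x * laplaceBeltrami n f x +
        2 * (w x * inner ℝ (gradient n f x) (gradient n g x))) ∂(riemannianVolume n) :=
    integral_congr_ae (Filter.Eventually.of_forall fun x ↦ by ring)
  have i12 : Integrable (fun x ↦ w x * f x * laplaceBeltrami n g x +
      w x * g x * laplaceBeltrami n f x) (riemannianVolume n) := i1.add i2
  have j23 : Integrable (fun x ↦ inner ℝ (gradient n (fun y ↦ w y * f y) x) (gradient n g x) +
      inner ℝ (gradient n (fun y ↦ w y * g y) x) (gradient n f x)) (riemannianVolume n) := j2.add j3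
  rw [hlhs, integral_add i12 i3, integral_add i1 i2, e1, e2, e3]
  simp only [hpt]
  rw [integral_sub j23 i3, integral_add j2 j3]
  ring

end Laplacian

section Weighted

variable {V : M → ℝ} (hV : ContMDiff (𝓡 n) 𝓘(ℝ, ℝ) ∞ V)
include hV

omit [T2Space M] [CompactSpace M] [IsManifold (𝓡 n) ∞ M]
  [IsContMDiffRiemannianBundle (𝓡 n) ∞ (EuclideanSpace ℝ (Fin n))
    (fun x : M ↦ TangentSpace (𝓡 n) x)] in
lemma integral_weightedVolume (F : M → ℝ) :
    ∫ x, F x ∂(weightedVolume n V) = ∫ x, Real.exp (V x) * F x ∂(riemannianVolume n) := by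
  have hm : Measurable fun x ↦ ENNReal.ofReal (Real.exp (V x)) :=
    (Real.continuous_exp.comp hV.continuous).measurable.ennreal_ofReal
  rw [weightedVolume, integral_withDensity_eq_integral_toReal_smul hm
    (Filter.Eventually.of_forall fun _ ↦ ENNReal.ofReal_lt_top)]
  refine integral_congr_ae (Filter.Eventually.of_forall fun x ↦ ?_)
  simp [ENNReal.toReal_ofReal (Real.exp_pos _).le]

omit [T2Space M] [IsManifold (𝓡 n) ∞ M] [BorelSpace M]
  [IsContMDiffRiemannianBundle (𝓡 n) ∞ (EuclideanSpace ℝ (Fin n))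
    (fun x : M ↦ TangentSpace (𝓡 n) x)] in
-- On a compact space `V` is bounded, so `e^V` is bounded below by a positive constant.
lemma isFiniteMeasure_riemannianVolume [IsFiniteMeasure (weightedVolume n V)] :
    IsFiniteMeasure (riemannianVolume n : Measure M) := by
  obtain ⟨C, hC⟩ := isCompact_univ.exists_bound_of_continuousOn hV.continuous.continuousOn
  have hle : ENNReal.ofReal (Real.exp (-C)) * riemannianVolume n (Set.univ : Set M) ≤
      weightedVolume n V Set.univ := by
    rw [weightedVolume, withDensity_apply _ MeasurableSet.univ, ← setLIntegral_const]
    refine lintegral_mono fun x ↦ ENNReal.ofReal_le_ofReal (Real.exp_le_exp.2 ?_)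
    exact (abs_le.1 (hC x (Set.mem_univ x))).1
  refine ⟨lt_top_iff_ne_top.2 fun htop ↦ ?_⟩
  rw [htop, ENNReal.mul_top (ENNReal.ofReal_pos.2 (Real.exp_pos _)).ne'] at hle
  exact (measure_lt_top (weightedVolume n V) Set.univ).not_ge hle

variable [IsFiniteMeasure (weightedVolume n V)]

lemma contMDiff_diffusionOp {h : M → ℝ} (hh : ContMDiff (𝓡 n) 𝓘(ℝ, ℝ) ∞ h) :
    ContMDiff (𝓡 n) 𝓘(ℝ, ℝ) ∞ (diffusionOp n V h) :=
  have := isFiniteMeasure_riemannianVolume (n := n) hV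
  (contMDiff_laplaceBeltrami hh).add (contMDiff_inner_gradient hh hV)

/-- The operator `L` is the generator of the Dirichlet form `∫ ⟪∇w, ∇h⟫ dμ`. -/
lemma integral_mul_diffusionOp {w h : M → ℝ} (hw : ContMDiff (𝓡 n) 𝓘(ℝ, ℝ) ∞ w)
    (hh : ContMDiff (𝓡 n) 𝓘(ℝ, ℝ) ∞ h) :
    ∫ x, w x * diffusionOp n V h x ∂(weightedVolume n V) =
      -∫ x, inner ℝ (gradient n w x) (gradient n h x) ∂(weightedVolume n V) := by
  have := isFiniteMeasure_riemannianVolume (n := n) hV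
  have hE : ContMDiff (𝓡 n) 𝓘(ℝ, ℝ) ∞ fun x ↦ Real.exp (V x) :=
    Real.contDiff_exp.contMDiff.comp hV
  have hEw : ContMDiff (𝓡 n) 𝓘(ℝ, ℝ) ∞ fun x ↦ Real.exp (V x) * w x := hE.mul hw
  rw [integral_weightedVolume hV, integral_weightedVolume hV, ← sub_eq_zero, sub_neg_eq_add,
    ← integral_add]
  -- Move the weight into the test function: differentiating `e^V` in `∇(e^V w)` produces exactly
  -- the drift term of `L`.
  · have hpt : ∀ x, Real.exp (V x) * (w x * diffusionOp n V h x) +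
        Real.exp (V x) * inner ℝ (gradient n w x) (gradient n h x) =
        (Real.exp (V x) * w x) * laplaceBeltrami n h x +
        inner ℝ (gradient n (fun x ↦ Real.exp (V x) * w x) x) (gradient n h x) := fun x ↦ by
      rw [gradient_mul (hE.mdifferentiable (by simp) x) (hw.mdifferentiable (by simp) x),
        gradient_comp (Real.hasDerivAt_exp (V x)).hasDerivWithinAt (fun _ ↦ Set.mem_univ _)
          (hV.mdifferentiable (by simp) x), diffusionOp]
      simp only [inner_add_left, inner_smul_left, conj_trivial]
      ring
    simp only [hpt]
    rw [integral_add, integral_mul_laplaceBeltrami hEw hh, neg_add_cancel]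
    · exact integrable_riemannianVolume_of_continuous
        (hEw.continuous.mul (contMDiff_laplaceBeltrami hh).continuous)
    · exact integrable_riemannianVolume_of_continuous (contMDiff_inner_gradient hh hEw).continuous
  · exact integrable_riemannianVolume_of_continuous
      (hE.continuous.mul (hw.continuous.mul (contMDiff_diffusionOp hV hh).continuous))
  · exact integrable_riemannianVolume_of_continuous
      (hE.continuous.mul (contMDiff_inner_gradient hh hw).continuous)

/-- The carré du champ operator is the pairing of gradients. -/
lemma carreDuChamp_eq_inner {f g : M → ℝ} (hf : ContMDiff (𝓡 n) 𝓘(ℝ, ℝ) ∞ f)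
    (hg : ContMDiff (𝓡 n) 𝓘(ℝ, ℝ) ∞ g) (x : M) :
    carreDuChamp n V f g x = inner ℝ (gradient n f x) (gradient n g x) := by
  have := isFiniteMeasure_riemannianVolume (n := n) hV
  rw [carreDuChamp, diffusionOp, diffusionOp, diffusionOp, laplaceBeltrami_mul hf hg,
    gradient_mul (hf.mdifferentiable (by simp) x) (hg.mdifferentiable (by simp) x),
    inner_add_right, inner_smul_right, inner_smul_right]
  ring

lemma contMDiff_carreDuChamp {f g : M → ℝ} (hf : ContMDiff (𝓡 n) 𝓘(ℝ, ℝ) ∞ f)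
    (hg : ContMDiff (𝓡 n) 𝓘(ℝ, ℝ) ∞ g) :
    ContMDiff (𝓡 n) 𝓘(ℝ, ℝ) ∞ (carreDuChamp n V f g) :=
  (contMDiff_inner_gradient hg hf).congr fun x ↦ carreDuChamp_eq_inner hV hf hg x

lemma contMDiff_carreDuChamp₂ {f g : M → ℝ} (hf : ContMDiff (𝓡 n) 𝓘(ℝ, ℝ) ∞ f)
    (hg : ContMDiff (𝓡 n) 𝓘(ℝ, ℝ) ∞ g) :
    ContMDiff (𝓡 n) 𝓘(ℝ, ℝ) ∞ (carreDuChamp₂ n V f g) := by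
  have h := ((contMDiff_diffusionOp hV (contMDiff_carreDuChamp hV hf hg)).sub
    (contMDiff_carreDuChamp hV (contMDiff_diffusionOp hV hf) hg)).sub
    (contMDiff_carreDuChamp hV hf (contMDiff_diffusionOp hV hg))
  exact h.div_const 2

end Weighted
end Global

/-! ### One-sided derivatives and convexity on an interval -/

section Interval

variable {J : Set ℝ}

lemma uniqueDiffOn_of_ordConnected_of_nontrivial (hJ : J.OrdConnected) (hJ' : J.Nontrivial) :
    UniqueDiffOn ℝ J := by
  obtain ⟨a, ha, b, hb, hab⟩ := hJ'.exists_lt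
  refine uniqueDiffOn_convex hJ.convex ⟨(a + b) / 2, ?_⟩
  refine interior_mono (hJ.out ha hb) ?_
  rw [interior_Icc]
  constructor <;> linarith

lemma iteratedDerivWithin_two (g : ℝ → ℝ) (J : Set ℝ) :
    iteratedDerivWithin 2 g J = derivWithin (derivWithin g J) J := by
  funext s
  rw [iteratedDerivWithin_eq_iterate]
  rfl

/-- The derivative of a convex function is monotone. -/
lemma iteratedDerivWithin_two_nonneg {g : ℝ → ℝ} (hg : ConvexOn ℝ J g)
    (hd : DifferentiableOn ℝ g J) (s : ℝ) : 0 ≤ iteratedDerivWithin 2 g J s := by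
  rw [iteratedDerivWithin_two]
  exact (hg.monotoneOn_derivWithin hd).derivWithin_nonneg

lemma contDiffOn_derivWithin (hJ : UniqueDiffOn ℝ J) {g : ℝ → ℝ} (hg : ContDiffOn ℝ ∞ g J) :
    ContDiffOn ℝ ∞ (derivWithin g J) J :=
  hg.derivWithin hJ le_rfl

lemma contDiffOn_iteratedDerivWithin_two (hJ : UniqueDiffOn ℝ J) {g : ℝ → ℝ}
    (hg : ContDiffOn ℝ ∞ g J) : ContDiffOn ℝ ∞ (iteratedDerivWithin 2 g J) J := by
  rw [iteratedDerivWithin_two]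
  exact contDiffOn_derivWithin hJ (contDiffOn_derivWithin hJ hg)

end Interval

/-! ### Cauchy–Schwarz and the integral condition -/

/-- A weighted Cauchy–Schwarz inequality, also valid when `∫ a f² = 0`. -/
lemma sq_integral_mul_div_le {X : Type*} [MeasurableSpace X] {μ : Measure X} {a f g : X → ℝ}
    (ha : ∀ x, 0 < a x) (hf : Integrable (fun x ↦ f x ^ 2 * a x) μ)
    (hfg : Integrable (fun x ↦ f x * g x) μ) (hg : Integrable (fun x ↦ g x ^ 2 / a x) μ) :
    (∫ x, f x * g x ∂μ) ^ 2 / ∫ x, f x ^ 2 * a x ∂μ ≤ ∫ x, g x ^ 2 / a x ∂μ := by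
  set C := ∫ x, f x ^ 2 * a x ∂μ with hC
  set P := ∫ x, f x * g x ∂μ with hP
  have hC0 : 0 ≤ C := integral_nonneg fun x ↦ mul_nonneg (sq_nonneg _) (ha x).le
  rcases hC0.eq_or_lt with h0 | hpos
  · rw [← h0, div_zero]
    exact integral_nonneg fun x ↦ div_nonneg (sq_nonneg _) (ha x).le
  -- The coefficient `P / C` minimizes the quadratic `t ↦ ∫ a (-t f + g / a)²`.
  · have hexp : ∀ x, a x * (-(P / C) * f x + g x / a x) ^ 2 =
        (P / C) ^ 2 * (f x ^ 2 * a x) + -(2 * (P / C)) * (f x * g x) + g x ^ 2 / a x := fun x ↦ by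
      have := (ha x).ne'
      field_simp
      ring
    have hnn : 0 ≤ ∫ x, a x * (-(P / C) * f x + g x / a x) ^ 2 ∂μ :=
      integral_nonneg fun x ↦ mul_nonneg (ha x).le (sq_nonneg _)
    simp only [hexp] at hnn
    have hsum : Integrable (fun x ↦ (P / C) ^ 2 * (f x ^ 2 * a x) +
        -(2 * (P / C)) * (f x * g x)) μ := (hf.const_mul _).add (hfg.const_mul _)
    rw [integral_add hsum hg,
      integral_add (hf.const_mul _) (hfg.const_mul _), integral_const_mul, integral_const_mul,
      ← hC, ← hP] at hnn
    have : (P / C) ^ 2 * C + -(2 * (P / C)) * P = -(P ^ 2 / C) := by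
      field_simp
      ring
    linarith

/-- The pointwise curvature-dimension condition implies the integral form one. -/
theorem integralCurvatureDimension_of_curvatureDimension {n : ℕ} {M : Type*} [TopologicalSpace M] [T2Space M] [CompactSpace M]
    [ChartedSpace (EuclideanSpace ℝ (Fin n)) M] [IsManifold (𝓡 n) ∞ M]
    [Bundle.RiemannianBundle (fun x : M ↦ TangentSpace (𝓡 n) x)]
    [IsContMDiffRiemannianBundle (𝓡 n) ∞ (EuclideanSpace ℝ (Fin n))
      (fun x : M ↦ TangentSpace (𝓡 n) x)]
    [MeasurableSpace M] [BorelSpace M]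
    (V : M → ℝ) (hV : ContMDiff (𝓡 n) 𝓘(ℝ, ℝ) ∞ V)
    [IsFiniteMeasure (weightedVolume n V)]
    (J : Set ℝ) (hJ : J.OrdConnected) (hJ' : J.Nontrivial)
    (Φ : ℝ → ℝ) (hΦ : ContDiffOn ℝ ∞ Φ J) (hΦconv : ConvexOn ℝ J Φ)
    (hΦ₂ : ∀ s ∈ J, iteratedDerivWithin 2 Φ J s ≠ 0)
    (hΦ₂inv : ConvexOn ℝ J (fun s ↦ -1 / iteratedDerivWithin 2 Φ J s))
    (K m : ℝ) (hm : 0 < m)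
    (hCD : CurvatureDimension n V K m) :
    IntegralCurvatureDimension n V J Φ K m := by
  intro f hf hfJ
  have hU := uniqueDiffOn_of_ordConnected_of_nontrivial hJ hJ'
  have hφ := contDiffOn_derivWithin hU hΦ
  have hΦ₂s := contDiffOn_iteratedDerivWithin_two hU hΦ
  have hder : ∀ s ∈ J, HasDerivWithinAt (derivWithin Φ J) (iteratedDerivWithin 2 Φ J s) J s := by
    intro s hs
    rw [iteratedDerivWithin_two]
    exact ((hφ.differentiableOn (by simp)) s hs).hasDerivWithinAt
  have hpos : ∀ x, 0 < iteratedDerivWithin 2 Φ J (f x) := fun x ↦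
    (iteratedDerivWithin_two_nonneg hΦconv (hΦ.differentiableOn (by simp)) _).lt_of_ne'
      (hΦ₂ _ (hfJ x))
  have hinvs : ContDiffOn ℝ ∞ (fun s ↦ -1 / iteratedDerivWithin 2 Φ J s) J :=
    contDiffOn_const.div hΦ₂s hΦ₂
  -- Concavity of `1/Φ''`: this gives the sign of the term that will be dropped.
  have hB : ∀ x, iteratedDerivWithin 2 (fun s ↦ 1 / iteratedDerivWithin 2 Φ J s) J (f x) ≤ 0 := by
    intro x
    have h1 : (fun s ↦ 1 / iteratedDerivWithin 2 Φ J s) =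
        -fun s ↦ -1 / iteratedDerivWithin 2 Φ J s := by
      funext s
      simp [neg_div]
    rw [h1, iteratedDerivWithin_neg, neg_nonpos]
    exact iteratedDerivWithin_two_nonneg hΦ₂inv (hinvs.differentiableOn (by simp)) _
  have hBs := contDiffOn_iteratedDerivWithin_two hU
    (contDiffOn_const (c := (1 : ℝ)).div hΦ₂s hΦ₂)
  have hcont : ∀ {g : ℝ → ℝ}, ContDiffOn ℝ ∞ g J → Continuous fun x ↦ g (f x) := fun hg ↦
    hg.continuousOn.comp_continuous hf.continuous hfJ
  have hint : ∀ {F : M → ℝ}, Continuous F → Integrable F (weightedVolume n V) := fun hF ↦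
    hF.integrable_of_hasCompactSupport (HasCompactSupport.of_compactSpace _)
  set h : M → ℝ := fun y ↦ derivWithin Φ J (f y) with hh_def
  have hh : ContMDiff (𝓡 n) 𝓘(ℝ, ℝ) ∞ h := by
    rw [← contMDiffOn_univ]
    exact hφ.contMDiffOn.comp hf.contMDiffOn fun x _ ↦ hfJ x
  have hca : Continuous fun x ↦ iteratedDerivWithin 2 Φ J (f x) := hcont hΦ₂s
  have hcL : Continuous (diffusionOp n V h) := (contMDiff_diffusionOp hV hh).continuous
  have hcΓ : Continuous (carreDuChamp n V f f) := (contMDiff_carreDuChamp hV hf hf).continuous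
  have hcΓ₂ : Continuous (carreDuChamp₂ n V h h) := (contMDiff_carreDuChamp₂ hV hh hh).continuous
  have hgrad : ∀ x, gradient n h x = iteratedDerivWithin 2 Φ J (f x) • gradient n f x := fun x ↦
    gradient_comp (hder _ (hfJ x)) hfJ (hf.mdifferentiable (by simp) x)
  have hΓh : ∀ x, carreDuChamp n V h h x =
      iteratedDerivWithin 2 Φ J (f x) ^ 2 * carreDuChamp n V f f x := fun x ↦ by
    rw [carreDuChamp_eq_inner hV hh hh, carreDuChamp_eq_inner hV hf hf, hgrad, inner_smul_left,
      inner_smul_right, conj_trivial]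
    ring
  -- Pairing `Lh` with `f` itself is what brings `q` and, as Cauchy–Schwarz weight, `C` into the
  -- estimate.
  have hparts : ∫ x, f x * diffusionOp n V h x ∂(weightedVolume n V) = -qPhi n V J Φ f := by
    rw [integral_mul_diffusionOp hV hf hh, qPhi]
    congr 2
    funext x
    rw [hgrad, inner_smul_right, carreDuChamp_eq_inner hV hf hf]
  have hcLa : Continuous fun x ↦ diffusionOp n V h x ^ 2 / iteratedDerivWithin 2 Φ J (f x) :=
    (hcL.pow 2).div hca fun x ↦ (hpos x).ne'
  have hCS := sq_integral_mul_div_le (μ := weightedVolume n V) hpos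
    (hint ((hf.continuous.pow 2).mul hca)) (hint (hf.continuous.mul hcL)) (hint hcLa)
  rw [hparts, neg_sq] at hCS
  have hpt : ∀ x, 2 * K * (iteratedDerivWithin 2 Φ J (f x) * carreDuChamp n V f f x) +
      2 / m * (diffusionOp n V h x ^ 2 / iteratedDerivWithin 2 Φ J (f x)) ≤
      2 * carreDuChamp₂ n V h h x / iteratedDerivWithin 2 Φ J (f x)
          - iteratedDerivWithin 2 (fun s ↦ 1 / iteratedDerivWithin 2 Φ J s) J (f x)
            * (iteratedDerivWithin 2 Φ J (f x) * carreDuChamp n V f f x) ^ 2 := fun x ↦ by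
    have h1 := hCD h hh x
    rw [hΓh] at h1
    have h2 := mul_nonneg (neg_nonneg.2 (hB x))
      (sq_nonneg (iteratedDerivWithin 2 Φ J (f x) * carreDuChamp n V f f x))
    have h3 : 2 * K * (iteratedDerivWithin 2 Φ J (f x) * carreDuChamp n V f f x) +
        2 / m * (diffusionOp n V h x ^ 2 / iteratedDerivWithin 2 Φ J (f x)) =
        2 * (K * (iteratedDerivWithin 2 Φ J (f x) ^ 2 * carreDuChamp n V f f x) +
          diffusionOp n V h x ^ 2 / m) / iteratedDerivWithin 2 Φ J (f x) := by
      have := (hpos x).ne'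
      field_simp
    have h4 := div_le_div_of_nonneg_right (mul_le_mul_of_nonneg_left h1 zero_le_two) (hpos x).le
    linarith
  have hmono := integral_mono (μ := weightedVolume n V)
    (((hint (hca.mul hcΓ)).const_mul (2 * K)).add ((hint hcLa).const_mul (2 / m)))
    (hint (((continuous_const.mul hcΓ₂).div hca fun x ↦ (hpos x).ne').sub
      ((hcont hBs).mul ((hca.mul hcΓ).pow 2)))) hpt
  refine ge_trans hmono ?_
  have hsplit := integral_add ((hint (hca.mul hcΓ)).const_mul (2 * K))
    ((hint hcLa).const_mul (2 / m))
  rw [integral_const_mul, integral_const_mul] at hsplit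
  refine ge_trans hsplit.ge ?_
  -- No case distinction on `C = 0` is needed, as division by zero gives zero on both sides.
  have h5 : 2 * qPhi n V J Φ f ^ 2 / (m * cPhi n V J Φ f) =
      2 / m * (qPhi n V J Φ f ^ 2 / cPhi n V J Φ f) := by
    rw [div_mul_div_comm]
  rw [h5]
  exact add_le_add le_rfl (mul_le_mul_of_nonneg_left hCS (by positivity))

end BakryEmery

end

theorem proposition1p2 {n : ℕ} {M : Type*} [TopologicalSpace M] [T2Space M] [CompactSpace M]
    [ChartedSpace (EuclideanSpace ℝ (Fin n)) M] [IsManifold (𝓡 n) ∞ M]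
    [Bundle.RiemannianBundle (fun x : M ↦ TangentSpace (𝓡 n) x)]
    [IsContMDiffRiemannianBundle (𝓡 n) ∞ (EuclideanSpace ℝ (Fin n))
      (fun x : M ↦ TangentSpace (𝓡 n) x)]
    [MeasurableSpace M] [BorelSpace M]
    (V : M → ℝ) (hV : ContMDiff (𝓡 n) 𝓘(ℝ, ℝ) ∞ V)
    (hμ : IsProbabilityMeasure (BakryEmery.weightedVolume n V))
    (J : Set ℝ) (hJ : J.OrdConnected) (hJ' : J.Nontrivial)
    (Φ : ℝ → ℝ) (hΦ : ContDiffOn ℝ ∞ Φ J) (hΦconv : ConvexOn ℝ J Φ)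
    (hΦ₂ : ∀ s ∈ J, iteratedDerivWithin 2 Φ J s ≠ 0)
    (hΦ₂conv : ConvexOn ℝ J (iteratedDerivWithin 2 Φ J))
    (hΦ₂inv : ConvexOn ℝ J (fun s ↦ -1 / iteratedDerivWithin 2 Φ J s))
    (K m : ℝ) (hm : 0 < m)
    (hCD : BakryEmery.CurvatureDimension n V K m) :
    BakryEmery.IntegralCurvatureDimension n V J Φ K m :=
  BakryEmery.integralCurvatureDimension_of_curvatureDimension V hV J hJ hJ' Φ hΦ hΦconv hΦ₂ hΦ₂inv
    K m hm hCD
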